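/- Simplicial complexes are finite and abstract. The geometric carrier $|X|$ of a simplicial complex $X$ with vertex set $V(X)$ is the space of all $f\colon V(X)\to[0,1]$ whose support is a simplex of $X$ and which satisfy $\sum_{x} f(x)=1$; $X$ triangulates a space $Y$ if $|X|$ is homeomorphic to $Y$. Let $(S^2\times S^2)_{16}$ be the simplicial complex with the 16 vertices $x_{ij}$, $1\le i,j\le 4$, whose facets are the images of the five sets $$x_{11}x_{22}x_{33}x_{12}x_{13},\quad x_{11}x_{22}x_{12}x_{14}x_{34},\quad x_{11}x_{22}x_{14}x_{24}x_{34},\quad x_{11}x_{22}x_{21}x_{24}x_{31},\quad x_{11}x_{22}x_{24}x_{31}x_{34}$$ under the group $A_4\times\mathbb{Z}_2$, where $A_4$ acts on the indices by $x_{ij}\mapsto x_{\sigma(i)\sigma(j)}$ and $\mathbb{Z}_2$ acts by $x_{ij}\leftrightarrow x_{ji}$. Let $\mathbb{CP}^2_{10}:=(S^2\times S^2)_{16}/\mathbb{Z}_2$ be the complex whose vertices are the $\mathbb{Z}_2$-orbits of the vertices $x_{ij}$ and whose simplices are the images of the simplices of $(S^2\times S^2)_{16}$ under the quotient map on vertices.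 Then $\mathbb{CP}^2_{10}$ is a simplicial complex with exactly 10 vertices which triangulates the complex projective plane $\mathbb{CP}^2$. Its full automorphism group is $A_4$: the action of $A_4$ on the indices induces an isomorphism from $A_4$ onto the group of all simplicial automorphisms of $\mathbb{CP}^2_{10}$. -/

import Mathlib

/-! ### Abstract simplicial complexes

We use Mathlib's `AbstractSimplicialComplex V`: a downward closed family of nonempty finite subsets
of `V` which contains all singletons, so that `V` is the vertex set. The empty simplex is not
listed among the faces. -/

namespace AbstractSimplicialComplex

/-- The set of vertices of a simplicial complex (the points `v` such that `{v}` is a simplex). -/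
def vertices {V : Type*} (K : AbstractSimplicialComplex V) : Set V :=
  {v | {v} ∈ K.faces}

/-- The geometric carrier `|K|`: the subspace of `[0,1]^V` of all `f` whose support is a simplex
of `K` and whose values sum to `1`, with the topology of pointwise convergence. -/
def carrier {V : Type*} [Fintype V] (K : AbstractSimplicialComplex V) : Set (V → ℝ) :=
  {f | (∀ v, f v ∈ Set.Icc (0 : ℝ) 1) ∧ (∃ s ∈ K.faces, (s : Set V) = Function.support f) ∧
    ∑ v, f v = 1}

/-- `K` triangulates the space `Y` if `|K|` is homeomorphic to `Y`. -/
def Triangulates {V : Type*} [Fintype V] (K : AbstractSimplicialComplex V)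
    (Y : Type*) [TopologicalSpace Y] : Prop :=
  Nonempty (K.carrier ≃ₜ Y)

/-- The full automorphism group of a simplicial complex: the permutations of its vertices which
map simplices to simplices and non-simplices to non-simplices. -/
def automorphismGroup {V : Type*} (K : AbstractSimplicialComplex V) :
    Subgroup (Equiv.Perm V) where
  carrier := {g | ∀ s : Finset V, s.map g.toEmbedding ∈ K.faces ↔ s ∈ K.faces}
  mul_mem' := by
    intro a b ha hb s
    have h : s.map (a * b).toEmbedding = (s.map b.toEmbedding).map a.toEmbedding := by
      rw [Finset.map_map]; rfl
    rw [h]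
    exact (ha _).trans (hb s)
  one_mem' := by
    intro s
    have h : s.map (1 : Equiv.Perm V).toEmbedding = s := Finset.map_refl
    rw [h]
  inv_mem' := by
    intro a ha s
    have h : (s.map (a⁻¹).toEmbedding).map a.toEmbedding = s := by
      rw [Finset.map_map]
      convert Finset.map_refl
      ext v
      simp
    rw [← ha, h]

open Classical in
/-- The quotient `K/G` of a simplicial complex by a group `G` of simplicial automorphisms. Its
vertices are the `G`-orbits of vertices of `K`, and its simplices are the images of the simplices
of `K` under the quotient map on the vertices. -/
noncomputable def quotient {V : Type*} (K : AbstractSimplicialComplex V)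
    (G : Subgroup K.automorphismGroup) :
    AbstractSimplicialComplex (MulAction.orbitRel.Quotient G V) where
  toPreAbstractSimplicialComplex := K.toPreAbstractSimplicialComplex.map
    (fun v => (Quotient.mk'' v : MulAction.orbitRel.Quotient G V))
  singleton_mem := by
    intro w
    obtain ⟨v, rfl⟩ := Quotient.exists_rep w
    exact ⟨{v}, K.singleton_mem v, Finset.image_singleton _ _⟩

end AbstractSimplicialComplex

/-! ### The complex `(S² × S²)₁₆`

The vertex `x_{ij}`, `1 ≤ i, j ≤ 4`, is represented by the pair `(i - 1, j - 1)` of elements of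
`Fin 4 = {0, 1, 2, 3}`. -/

namespace S2xS2

/-- The permutation `x_{ij} ↦ x_{σ(i)σ(j)}` of the vertices. -/
def indexPerm (σ : Equiv.Perm (Fin 4)) : Equiv.Perm (Fin 4 × Fin 4) :=
  Equiv.prodCongr σ σ

/-- The permutation `x_{ij} ↦ x_{ji}` of the vertices. -/
def flip : Equiv.Perm (Fin 4 × Fin 4) :=
  Equiv.prodComm (Fin 4) (Fin 4)

/-- The five basic facets
`x₁₁x₂₂x₃₃x₁₂x₁₃`, `x₁₁x₂₂x₁₂x₁₄x₃₄`, `x₁₁x₂₂x₁₄x₂₄x₃₄`, `x₁₁x₂₂x₂₁x₂₄x₃₁`, `x₁₁x₂₂x₂₄x₃₁x₃₄`. -/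
def basicFacets : Finset (Finset (Fin 4 × Fin 4)) :=
  { {(0, 0), (1, 1), (2, 2), (0, 1), (0, 2)},
    {(0, 0), (1, 1), (0, 1), (0, 3), (2, 3)},
    {(0, 0), (1, 1), (0, 3), (1, 3), (2, 3)},
    {(0, 0), (1, 1), (1, 0), (1, 3), (2, 0)},
    {(0, 0), (1, 1), (1, 3), (2, 0), (2, 3)} }

/-- The facets: the images of the basic facets under the group `A₄ × ℤ₂`, where `A₄` acts on the
indices and `ℤ₂` acts by `x_{ij} ↔ x_{ji}`. -/
def facets : Set (Finset (Fin 4 × Fin 4)) :=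
  {f | ∃ b ∈ basicFacets, ∃ σ ∈ alternatingGroup (Fin 4),
    f = b.map (indexPerm σ).toEmbedding ∨ f = b.map (flip * indexPerm σ).toEmbedding}

theorem exists_even_mem_basicFacets (v : Fin 4 × Fin 4) :
    ∃ b ∈ basicFacets, ∃ σ ∈ alternatingGroup (Fin 4),
      v ∈ b.map (indexPerm σ).toEmbedding := by
  refine ⟨{(0, 0), (1, 1), (2, 2), (0, 1), (0, 2)}, by simp [basicFacets], ?_⟩
  simp only [Equiv.Perm.mem_alternatingGroup]
  revert v
  decide

/-- The simplicial complex `(S² × S²)₁₆`: its simplices are the nonempty subsets of the facets. -/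
def complex16 : AbstractSimplicialComplex (Fin 4 × Fin 4) where
  faces := {s | s.Nonempty ∧ ∃ f ∈ facets, s ⊆ f}
  isRelLowerSet_faces := by
    rintro s ⟨hs, f, hf, hsf⟩
    exact ⟨hs, fun t hts ht => ⟨ht, f, hf, hts.trans hsf⟩⟩
  singleton_mem := by
    intro v
    obtain ⟨b, hb, σ, hσ, hv⟩ := exists_even_mem_basicFacets v
    exact ⟨Finset.singleton_nonempty v, _, ⟨b, hb, σ, hσ, Or.inl rfl⟩,
      Finset.singleton_subset_iff.mpr hv⟩

theorem flip_mul_flip : flip * flip = 1 := by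
  ext v <;> rfl

theorem map_flip_map (g : Equiv.Perm (Fin 4 × Fin 4)) (s : Finset (Fin 4 × Fin 4)) :
    (s.map g.toEmbedding).map flip.toEmbedding = s.map (flip * g).toEmbedding := by
  rw [Finset.map_map]; rfl

theorem map_flip_mem_facets {f : Finset (Fin 4 × Fin 4)} (hf : f ∈ facets) :
    f.map flip.toEmbedding ∈ facets := by
  obtain ⟨b, hb, σ, hσ, rfl | rfl⟩ := hf
  · exact ⟨b, hb, σ, hσ, Or.inr (map_flip_map _ _)⟩
  · refine ⟨b, hb, σ, hσ, Or.inl ?_⟩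
    rw [map_flip_map, ← mul_assoc, flip_mul_flip, one_mul]

theorem map_flip_mem {s : Finset (Fin 4 × Fin 4)} (hs : s ∈ complex16.faces) :
    s.map flip.toEmbedding ∈ complex16.faces := by
  obtain ⟨hne, f, hf, hsf⟩ := hs
  exact ⟨hne.map, _, map_flip_mem_facets hf, Finset.map_subset_map.mpr hsf⟩

/-- The flip `x_{ij} ↔ x_{ji}` is an automorphism of `(S² × S²)₁₆`. -/
theorem flip_mem : flip ∈ complex16.automorphismGroup := by
  intro s
  refine ⟨fun h => ?_, map_flip_mem⟩
  have h2 := map_flip_mem h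
  rw [map_flip_map, flip_mul_flip] at h2
  have h3 : s.map (1 : Equiv.Perm (Fin 4 × Fin 4)).toEmbedding = s := Finset.map_refl
  rwa [h3] at h2

/-- The group `ℤ₂` of automorphisms of `(S² × S²)₁₆` generated by the flip `x_{ij} ↔ x_{ji}`. -/
def Z2 : Subgroup complex16.automorphismGroup :=
  Subgroup.zpowers ⟨flip, flip_mem⟩

end S2xS2

/-! ### The complex `ℂP²₁₀` -/

/-- The vertices of `ℂP²₁₀`: the `ℤ₂`-orbits of vertices of `(S² × S²)₁₆`. -/
abbrev CP2Vertex : Type := MulAction.orbitRel.Quotient S2xS2.Z2 (Fin 4 × Fin 4)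

noncomputable instance : Fintype CP2Vertex := Fintype.ofFinite _

/-- The simplicial complex `ℂP²₁₀ = (S² × S²)₁₆ / ℤ₂`. -/
noncomputable def complexCP2 : AbstractSimplicialComplex CP2Vertex :=
  S2xS2.complex16.quotient S2xS2.Z2

/-- The vertex of `ℂP²₁₀` which is the orbit `{x_{ij}, x_{ji}}`. -/
def vertexCP2 (i j : Fin 4) : CP2Vertex := Quotient.mk'' (i, j)

/-! ### The complex projective plane -/

/-- The complex projective plane: the set of one-dimensional subspaces of `ℂ³`. -/
def ComplexProjectivePlane : Type := Projectivization ℂ (Fin 3 → ℂ)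

/-- The topology of the complex projective plane is the quotient topology from `ℂ³ ∖ {0}`. -/
noncomputable instance : TopologicalSpace ComplexProjectivePlane :=
  TopologicalSpace.coinduced
    (fun v : {v : Fin 3 → ℂ // v ≠ 0} => Projectivization.mk ℂ v.1 v.2) inferInstance

/-!
The vertex `x_{ij}` stands for the pair of vertices `i`, `j` of the tetrahedron, and
`(S² × S²)₁₆` is a subdivision of the product of two copies of the boundary of the tetrahedron
without new vertices. A function `f` in its carrier is a transport plan with marginals
`p i = ∑ j, f (i, j)` and `q j = ∑ i, f (i, j)`. Its simplices are the nonempty sets of vertices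
that miss a row and a column and are pairwise compatible (`S2xS2.mem_complex16_faces`): an index is
never both the source of one off-diagonal vertex and the target of another, and two off-diagonal
vertices `x_{ij}`, `x_{kl}` with four different indices form an even arrangement `ijkl`. The first condition
says that a plan in the carrier leaves in place as much mass as possible; the second one resolves
the only remaining ambiguity, the transport from two indices to two others. Hence every pair
`(p, q)` of points of the boundary is the pair of marginals of exactly one point of the carrier,
given by an explicit formula in terms of minima and maxima (`S2xS2.transport`), which is continuous.

Because the compatibility with one off-diagonal vertex fixes the orientation of every other one, two
points of the carrier of `(S² × S²)₁₆` have the same image in that of `ℂP²₁₀` only if they are equal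
or exchanged by the flip. So the carrier of `ℂP²₁₀` is the space of unordered pairs of points of the
2-sphere (`S2xS2.fold_transport_eq_iff`). The complex projective plane is the space of unordered
pairs of points of the projective line, since a binary quadratic form is the product of two linear
forms, unique up to order and scalars (`ComplexProjectivePlane.symPoint_eq_iff`). Both descriptions
are pulled back along the Hopf map to pairs of unit vectors of `ℂ²`: there are two continuous
surjections from a compact space to Hausdorff spaces with the same fibres
(`nonempty_homeomorph_of_fibers`).

For the automorphism group, the four vertices `x_{ii}` are recognized by the fact that all triples
containing one of them are simplices. The simplices that contain three of them determine the action
of an automorphism on the other vertices, and a path `x_{ij}`, `x_{jk}`, `x_{kl}` is a simplex only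
for even arrangements `ijkl`, which excludes odd permutations.
-/

/-! ### Simplices of `(S² × S²)₁₆` -/

namespace S2xS2

/-- The Vandermonde product of four indices: it is positive on even arrangements of `0, 1, 2, 3`,
negative on odd ones, and zero if two of the indices coincide. -/
def vandermonde (i j k l : Fin 4) : ℤ :=
  (j.val - i.val) * (k.val - i.val) * (l.val - i.val) * (k.val - j.val) * (l.val - j.val) *
    (l.val - k.val)

/-- Two vertices are compatible if they span a simplex. Diagonal vertices are compatible with
everything. Two off-diagonal vertices `x_{ij}`, `x_{kl}` are compatible if no index is a row index
of one and a column index of the other, and `ijkl` is not an odd arrangement of the indices. -/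
def Compatible (v w : Fin 4 × Fin 4) : Prop :=
  v.1 = v.2 ∨ w.1 = w.2 ∨ (v.2 ≠ w.1 ∧ v.1 ≠ w.2 ∧ 0 ≤ vandermonde v.1 v.2 w.1 w.2)

instance (v w : Fin 4 × Fin 4) : Decidable (Compatible v w) := by
  unfold Compatible; infer_instance

/-- A set of vertices is admissible if its elements are pairwise compatible and it misses some row
and some column. -/
def Admissible (s : Finset (Fin 4 × Fin 4)) : Prop :=
  (∀ v ∈ s, ∀ w ∈ s, Compatible v w) ∧ (∃ k, ∀ v ∈ s, v.1 ≠ k) ∧ ∃ l, ∀ v ∈ s, v.2 ≠ l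

instance (s : Finset (Fin 4 × Fin 4)) : Decidable (Admissible s) := by
  unfold Admissible; infer_instance

theorem Admissible.mono {s t : Finset (Fin 4 × Fin 4)} (h : Admissible t) (hst : s ⊆ t) :
    Admissible s :=
  ⟨fun v hv w hw => h.1 v (hst hv) w (hst hw),
    h.2.1.imp fun _ hk v hv => hk v (hst hv), h.2.2.imp fun _ hl v hv => hl v (hst hv)⟩

theorem compatible_indexPerm : ∀ σ : Equiv.Perm (Fin 4), Equiv.Perm.sign σ = 1 →
    ∀ v w, Compatible v w → Compatible (indexPerm σ v) (indexPerm σ w) := by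
  decide +kernel

theorem compatible_flip : ∀ v w, Compatible v w → Compatible (flip v) (flip w) := by
  decide +kernel

theorem Admissible.map_indexPerm {s : Finset (Fin 4 × Fin 4)} (h : Admissible s)
    {σ : Equiv.Perm (Fin 4)} (hσ : σ ∈ alternatingGroup (Fin 4)) :
    Admissible (s.map (indexPerm σ).toEmbedding) := by
  obtain ⟨hc, ⟨k, hk⟩, l, hl⟩ := h
  refine ⟨?_, ⟨σ k, ?_⟩, σ l, ?_⟩
  · simp only [Finset.forall_mem_map]
    exact fun v hv w hw =>
      compatible_indexPerm σ (Equiv.Perm.mem_alternatingGroup.1 hσ) v w (hc v hv w hw)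
  · simp only [Finset.forall_mem_map]
    exact fun v hv => fun e => hk v hv (σ.injective e)
  · simp only [Finset.forall_mem_map]
    exact fun v hv => fun e => hl v hv (σ.injective e)

theorem Admissible.map_flip {s : Finset (Fin 4 × Fin 4)} (h : Admissible s) :
    Admissible (s.map flip.toEmbedding) := by
  obtain ⟨hc, ⟨k, hk⟩, l, hl⟩ := h
  refine ⟨?_, ⟨l, ?_⟩, k, ?_⟩
  · simp only [Finset.forall_mem_map]
    exact fun v hv w hw => compatible_flip v w (hc v hv w hw)
  · simp only [Finset.forall_mem_map]
    exact hl
  · simp only [Finset.forall_mem_map]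
    exact hk

theorem admissible_basicFacets : ∀ b ∈ basicFacets, Admissible b := by
  simp only [basicFacets, Finset.forall_mem_insert, Finset.mem_singleton, forall_eq]
  decide +kernel

theorem admissible_of_mem_facets {f : Finset (Fin 4 × Fin 4)} (hf : f ∈ facets) :
    Admissible f := by
  obtain ⟨b, hb, σ, hσ, rfl | rfl⟩ := hf
  · exact (admissible_basicFacets b hb).map_indexPerm hσ
  · rw [← map_flip_map]
    exact ((admissible_basicFacets b hb).map_indexPerm hσ).map_flip

theorem map_indexPerm_mem_facets {f : Finset (Fin 4 × Fin 4)} (hf : f ∈ facets)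
    {σ : Equiv.Perm (Fin 4)} (hσ : σ ∈ alternatingGroup (Fin 4)) :
    f.map (indexPerm σ).toEmbedding ∈ facets := by
  obtain ⟨b, hb, τ, hτ, rfl | rfl⟩ := hf
  · exact ⟨b, hb, σ * τ, mul_mem hσ hτ, Or.inl (by rw [Finset.map_map]; rfl)⟩
  · exact ⟨b, hb, σ * τ, mul_mem hσ hτ, Or.inr (by rw [Finset.map_map]; rfl)⟩

/-- The facets of the triangulated product cell `{0, 1, 2} × {0, 1, 2}`. -/
def evenCellFacets : List (Finset (Fin 4 × Fin 4)) :=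
  [ {(0, 0), (1, 1), (2, 2), (0, 1), (0, 2)}, {(0, 0), (1, 1), (2, 2), (0, 1), (2, 1)},
    {(0, 0), (1, 1), (2, 2), (1, 0), (1, 2)}, {(0, 0), (1, 1), (2, 2), (2, 0), (2, 1)},
    {(0, 0), (1, 1), (2, 2), (0, 2), (1, 2)}, {(0, 0), (1, 1), (2, 2), (1, 0), (2, 0)} ]

/-- The facets of the triangulated product cell `{0, 1, 2} × {0, 1, 3}`. -/
def oddCellFacets : List (Finset (Fin 4 × Fin 4)) :=
  [ {(0, 0), (1, 1), (0, 1), (0, 3), (2, 3)}, {(0, 0), (1, 1), (0, 3), (1, 3), (2, 3)},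
    {(0, 0), (1, 1), (1, 3), (2, 0), (2, 3)}, {(0, 0), (1, 1), (0, 1), (2, 1), (2, 3)},
    {(0, 0), (1, 1), (1, 0), (1, 3), (2, 0)}, {(0, 0), (1, 1), (2, 0), (2, 1), (2, 3)} ]

theorem mem_facets_of_mem_cellFacets :
    ∀ f, f ∈ evenCellFacets ∨ f ∈ oddCellFacets → f ∈ facets := by
  simp only [← List.mem_append]
  simp only [facets, Set.mem_ofPred_eq, Equiv.Perm.mem_alternatingGroup, basicFacets,
    Finset.exists_mem_insert, Finset.mem_singleton, exists_eq_left]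
  decide +kernel

/-- Backtracking search: `covers U Fs c` certifies that every set of pairwise compatible elements
of `U` which contains the elements of `c` is a subset of a member of `Fs`. A member of `Fs` is
discarded if it misses an element of `c`; otherwise a set which is not a subset of it has an element
outside it, and all choices of such an element are tried. -/
def covers (U : List (Fin 4 × Fin 4)) :
    List (Finset (Fin 4 × Fin 4)) → List (Fin 4 × Fin 4) → Bool
  | [], _ => false
  | F :: Fs, c =>
    bif c.any (fun w => w ∉ F) then covers U Fs c
    else U.all fun v => v ∈ F || c.any (fun w => ¬Compatible v w) || covers U Fs (v :: c)

theorem exists_of_covers {U : List (Fin 4 × Fin 4)} {s : Finset (Fin 4 × Fin 4)}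
    (hU : ∀ v ∈ s, v ∈ U) (hs : ∀ v ∈ s, ∀ w ∈ s, Compatible v w)
    (Fs : List (Finset (Fin 4 × Fin 4))) (c : List (Fin 4 × Fin 4)) (hc : ∀ v ∈ c, v ∈ s)
    (h : covers U Fs c = true) : ∃ F ∈ Fs, s ⊆ F := by
  induction Fs generalizing c with
  | nil => simp [covers] at h
  | cons F Fs ih =>
    by_cases hsF : s ⊆ F
    · exact ⟨F, List.mem_cons_self, hsF⟩
    suffices ∃ F ∈ Fs, s ⊆ F from this.imp fun _ hF => ⟨List.mem_cons_of_mem _ hF.1, hF.2⟩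
    rw [covers] at h
    cases hd : c.any (fun w => w ∉ F) with
    | true =>
      rw [hd, cond_true] at h
      exact ih c hc h
    | false =>
      obtain ⟨v, hv, hvF⟩ := Finset.not_subset.1 hsF
      rw [hd, cond_false, List.all_eq_true] at h
      have hv' := h v (hU v hv)
      simp only [Bool.or_eq_true, decide_eq_true_eq, hvF, false_or, List.any_eq_true] at hv'
      rcases hv' with ⟨w, hw, hvw⟩ | hv'
      · exact absurd (hs v hv w (hc w hw)) hvw
      · exact ih (v :: c) (by simpa [hv] using hc) hv'

/-- Under the alternating group every pair of a missing row and a missing column can be moved to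
one of two standard positions. -/
theorem exists_even_standard : ∀ k l : Fin 4, ∃ σ : Equiv.Perm (Fin 4),
    Equiv.Perm.sign σ = 1 ∧ σ k = 3 ∧ (σ l = 3 ∨ σ l = 2) := by
  decide +kernel

theorem exists_cellFacet {s : Finset (Fin 4 × Fin 4)} (hs : ∀ v ∈ s, ∀ w ∈ s, Compatible v w)
    (hk : ∀ v ∈ s, v.1 ≠ 3) {l : Fin 4} (hl : l = 3 ∨ l = 2) (hsl : ∀ v ∈ s, v.2 ≠ l) :
    ∃ f ∈ facets, s ⊆ f := by
  rcases hl with rfl | rfl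
  · obtain ⟨f, hf, hsf⟩ := exists_of_covers
      (U := [(0, 0), (0, 1), (0, 2), (1, 0), (1, 1), (1, 2), (2, 0), (2, 1), (2, 2)])
      (fun v hv => by
        have h : ∀ v : Fin 4 × Fin 4, v.1 ≠ 3 → v.2 ≠ 3 → v ∈
            [(0, 0), (0, 1), (0, 2), (1, 0), (1, 1), (1, 2), (2, 0), (2, 1), (2, 2)] := by
          decide
        exact h v (hk v hv) (hsl v hv)) hs evenCellFacets [] (by simp) (by decide +kernel)
    exact ⟨f, mem_facets_of_mem_cellFacets f (Or.inl hf), hsf⟩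
  · obtain ⟨f, hf, hsf⟩ := exists_of_covers
      (U := [(0, 0), (0, 1), (0, 3), (1, 0), (1, 1), (1, 3), (2, 0), (2, 1), (2, 3)])
      (fun v hv => by
        have h : ∀ v : Fin 4 × Fin 4, v.1 ≠ 3 → v.2 ≠ 2 → v ∈
            [(0, 0), (0, 1), (0, 3), (1, 0), (1, 1), (1, 3), (2, 0), (2, 1), (2, 3)] := by
          decide
        exact h v (hk v hv) (hsl v hv)) hs oddCellFacets [] (by simp) (by decide +kernel)
    exact ⟨f, mem_facets_of_mem_cellFacets f (Or.inr hf), hsf⟩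

theorem Admissible.exists_facet {s : Finset (Fin 4 × Fin 4)} (h : Admissible s) :
    ∃ f ∈ facets, s ⊆ f := by
  have hc := h.1
  obtain ⟨-, ⟨k, hk⟩, l, hl⟩ := h
  obtain ⟨σ, hσ, hσk, hσl⟩ := exists_even_standard k l
  obtain ⟨f, hf, hsf⟩ := exists_cellFacet (s := s.map (indexPerm σ).toEmbedding)
    (by
      simp only [Finset.forall_mem_map]
      exact fun v hv w hw => compatible_indexPerm σ hσ v w (hc v hv w hw))
    (by
      simp only [Finset.forall_mem_map]
      exact fun v hv e => hk v hv (σ.injective (e.trans hσk.symm)))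
    hσl
    (by
      simp only [Finset.forall_mem_map]
      exact fun v hv e => hl v hv (σ.injective e))
  refine ⟨f.map (indexPerm σ⁻¹).toEmbedding, map_indexPerm_mem_facets
    hf (inv_mem (Equiv.Perm.mem_alternatingGroup.2 hσ)), ?_⟩
  intro v hv
  rw [Finset.mem_map]
  exact ⟨indexPerm σ v, hsf (Finset.mem_map_of_mem _ hv),
    Prod.ext (σ.symm_apply_apply _) (σ.symm_apply_apply _)⟩

theorem mem_complex16_faces {s : Finset (Fin 4 × Fin 4)} :
    s ∈ complex16.faces ↔ s.Nonempty ∧ Admissible s :=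
  and_congr_right fun _ =>
    ⟨fun ⟨_, hf, hsf⟩ => (admissible_of_mem_facets hf).mono hsf, Admissible.exists_facet⟩

/-! ### Vertices and simplices of `ℂP²₁₀` -/

/-- The vertex of `ℂP²₁₀` to which a vertex of `(S² × S²)₁₆` is mapped. -/
def orbitOf (v : Fin 4 × Fin 4) : CP2Vertex := vertexCP2 v.1 v.2

theorem orbitOf_eq_iff (v w : Fin 4 × Fin 4) : orbitOf v = orbitOf w ↔ v = w ∨ v = flip w := by
  change (Quotient.mk'' v : CP2Vertex) = Quotient.mk'' w ↔ _
  rw [Quotient.eq'', MulAction.orbitRel_apply, MulAction.mem_orbit_iff]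
  have hsq : (⟨flip, flip_mem⟩ : complex16.automorphismGroup) ^ 2 = 1 := by
    rw [sq]; exact Subtype.ext flip_mul_flip
  constructor
  · rintro ⟨⟨g, n, rfl⟩, rfl⟩
    rcases Int.even_or_odd' n with ⟨m, rfl | rfl⟩
    · left
      have : (⟨flip, flip_mem⟩ : complex16.automorphismGroup) ^ (2 * m) = 1 := by
        rw [zpow_mul]; norm_cast; rw [hsq, one_zpow]
      simp only [this]
      rfl
    · right
      have : (⟨flip, flip_mem⟩ : complex16.automorphismGroup) ^ (2 * m + 1) =
          ⟨flip, flip_mem⟩ := by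
        rw [zpow_add, zpow_mul]; norm_cast; rw [hsq, one_zpow, one_mul, pow_one]
      simp only [this]
      rfl
  · rintro (rfl | rfl)
    · exact ⟨1, one_smul _ _⟩
    · exact ⟨⟨_, Subgroup.mem_zpowers _⟩, rfl⟩

theorem vertexCP2_eq_iff (i j k l : Fin 4) :
    vertexCP2 i j = vertexCP2 k l ↔ i = k ∧ j = l ∨ i = l ∧ j = k := by
  have := orbitOf_eq_iff (i, j) (k, l)
  simpa [orbitOf, flip, Prod.ext_iff] using this

theorem vertexCP2_comm (i j : Fin 4) : vertexCP2 i j = vertexCP2 j i := by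
  simp [vertexCP2_eq_iff]

theorem orbitOf_flip (v : Fin 4 × Fin 4) : orbitOf (flip v) = orbitOf v :=
  (orbitOf_eq_iff _ _).2 (Or.inr rfl)

theorem orbitOf_surjective : Function.Surjective orbitOf := Quotient.exists_rep

theorem exists_vertexCP2 (o : CP2Vertex) : ∃ i j, vertexCP2 i j = o := by
  obtain ⟨⟨i, j⟩, rfl⟩ := Quotient.exists_rep o
  exact ⟨i, j, rfl⟩

/-- The vertices of `ℂP²₁₀` correspond to unordered pairs of indices. -/
noncomputable def vertexEquivSym2 : CP2Vertex ≃ Sym2 (Fin 4) :=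
  (Equiv.ofBijective
    (Sym2.lift ⟨vertexCP2, vertexCP2_comm⟩)
    ⟨by
      intro a b
      induction a, b using Sym2.inductionOn₂ with
      | _ i j k l =>
        intro h
        rw [Sym2.lift_mk, Sym2.lift_mk] at h
        rw [Sym2.eq_iff]
        exact (vertexCP2_eq_iff _ _ _ _).1 h,
    fun o => by
      obtain ⟨i, j, rfl⟩ := exists_vertexCP2 o
      exact ⟨s(i, j), rfl⟩⟩).symm

theorem ncard_vertices : complexCP2.vertices.ncard = 10 := by
  have h : complexCP2.vertices = Set.univ := Set.eq_univ_of_forall complexCP2.singleton_mem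
  rw [h, Set.ncard_univ, Nat.card_congr vertexEquivSym2, Nat.card_eq_fintype_card, Sym2.card]
  rfl

open Classical in
theorem mem_complexCP2_faces {t : Finset CP2Vertex} :
    t ∈ complexCP2.faces ↔ ∃ s : Finset (Fin 4 × Fin 4), s.Nonempty ∧ Admissible s ∧
      s.image orbitOf = t := by
  simp only [← and_assoc, ← mem_complex16_faces]
  rfl

/-! ### The carrier of `(S² × S²)₁₆` as a product of two tetrahedron boundaries -/

/-- The boundary of the standard tetrahedron, a 2-sphere. -/
def tetrahedronBoundary : Set (Fin 4 → ℝ) :=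
  {p | (∀ i, 0 ≤ p i) ∧ ∑ i, p i = 1 ∧ ∃ i, p i = 0}

/-- The first marginal of a function on the vertices `x_{ij}`. -/
def rowSum (f : Fin 4 × Fin 4 → ℝ) (i : Fin 4) : ℝ := ∑ j, f (i, j)

/-- The second marginal of a function on the vertices `x_{ij}`. -/
def colSum (f : Fin 4 × Fin 4 → ℝ) (j : Fin 4) : ℝ := ∑ i, f (i, j)

/-- The positive part of the difference of two functions. -/
def excess (p q : Fin 4 → ℝ) (i : Fin 4) : ℝ := max (p i - q i) 0

/-- For `a ≠ c`, the index `b` for which the arrangement `a, c, b, d` of the four indices is even;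
the values for `a = c` are irrelevant. -/
def evenNext (a c : Fin 4) : Fin 4 :=
  (![![0, 2, 3, 1], ![3, 1, 0, 2], ![1, 3, 2, 0], ![2, 0, 1, 3]] : Fin 4 → Fin 4 → Fin 4) a c

/-- The point of the carrier of `(S² × S²)₁₆` with marginals `p` and `q`. It is the transport plan
from `p` to `q` which leaves `min (p i) (q i)` in place for every `i`; the remaining mass is
transported from the indices where `p` exceeds `q` to the indices where `q` exceeds `p`, in the way
prescribed by the compatibility of vertices. -/
def transport (p q : Fin 4 → ℝ) (v : Fin 4 × Fin 4) : ℝ :=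
  if v.1 = v.2 then min (p v.1) (q v.1)
  else min (excess q p v.2) (max (excess p q v.1 - excess q p (evenNext v.1 v.2)) 0)

theorem continuous_transport :
    Continuous fun x : (Fin 4 → ℝ) × (Fin 4 → ℝ) => transport x.1 x.2 := by
  refine continuous_pi fun v => ?_
  unfold transport excess
  split_ifs <;> fun_prop

theorem excess_nonneg (p q : Fin 4 → ℝ) (i : Fin 4) : 0 ≤ excess p q i := le_max_right _ _

theorem excess_mul_excess (p q : Fin 4 → ℝ) (i : Fin 4) : excess p q i * excess q p i = 0 := by
  unfold excess
  rcases le_total (p i) (q i) with h | h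
  · rw [max_eq_right (by linarith), zero_mul]
  · rw [max_eq_right (a := q i - p i) (by linarith), mul_zero]

theorem min_add_excess (p q : Fin 4 → ℝ) (i : Fin 4) : min (p i) (q i) + excess p q i = p i := by
  unfold excess
  rcases le_total (p i) (q i) with h | h
  · rw [min_eq_left h, max_eq_right (by linarith), add_zero]
  · rw [min_eq_right h, max_eq_left (by linarith)]; ring

theorem sum_excess {p q : Fin 4 → ℝ} (h : ∑ i, p i = ∑ i, q i) :
    ∑ i, excess p q i = ∑ i, excess q p i := by
  have hp := Finset.sum_congr rfl fun i (_ : i ∈ Finset.univ) => min_add_excess p q i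
  have hq := Finset.sum_congr rfl fun i (_ : i ∈ Finset.univ) => min_add_excess q p i
  rw [Finset.sum_add_distrib] at hp hq
  simp only [min_comm (q _) (p _)] at hq
  linarith

/-- The sum of the off-diagonal entries of a row of `transport p q`. Here `o` is the mass leaving
the row, and `x`, `y`, `z` are the masses entering the three other indices in cyclic order. -/
theorem row_identity {o x y z : ℝ} (ho : 0 ≤ o) (hx : 0 ≤ x) (hy : 0 ≤ y) (hz : 0 ≤ z)
    (h : o = 0 ∨ o = x + y + z ∨ o ≤ x + y + z ∧ (x = 0 ∨ y = 0 ∨ z = 0)) :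
    min x (max (o - y) 0) + min y (max (o - z) 0) + min z (max (o - x) 0) = o := by
  rcases h with rfl | h | ⟨hle, rfl | rfl | rfl⟩
  · simp [hx, hy, hz]
  · rw [max_eq_left (by linarith), max_eq_left (by linarith), max_eq_left (by linarith),
      min_eq_left (by linarith), min_eq_left (by linarith), min_eq_left (by linarith), h]
  all_goals
    simp only [sub_zero, max_eq_left ho, min_def, max_def]
    split_ifs <;> linarith

/-- The sum of the off-diagonal entries of a column of `transport p q`. Here `i` is the mass
entering the column, and `a`, `b`, `d`, resp. `a'`, `b'`, `d'`, are the masses leaving, resp.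
entering, the three other indices in cyclic order. -/
theorem col_identity {i a b d a' b' d' : ℝ} (hi : 0 ≤ i) (ha : 0 ≤ a) (hb : 0 ≤ b) (hd : 0 ≤ d)
    (ha' : 0 ≤ a') (hb' : 0 ≤ b') (hd' : 0 ≤ d') (haa : a = 0 ∨ a' = 0) (hbb : b = 0 ∨ b' = 0)
    (hdd : d = 0 ∨ d' = 0) (h : i = 0 ∨ i + a' + b' + d' = a + b + d) :
    min i (max (a - b') 0) + min i (max (b - d') 0) + min i (max (d - a') 0) = i := by
  rcases h with rfl | h
  · simp
  · rcases haa with rfl | rfl <;> rcases hbb with rfl | rfl <;> rcases hdd with rfl | rfl <;>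
      simp only [zero_sub, sub_zero, max_self, max_eq_left ha, max_eq_left hb,
        max_eq_left hd, max_eq_right (neg_nonpos.2 ha'), max_eq_right (neg_nonpos.2 hb'),
        max_eq_right (neg_nonpos.2 hd'), min_eq_right hi, min_def, max_def] <;>
      first | linarith | (split_ifs <;> linarith)

theorem transport_self (p q : Fin 4 → ℝ) (a : Fin 4) : transport p q (a, a) = min (p a) (q a) :=
  if_pos rfl

theorem transport_of_ne (p q : Fin 4 → ℝ) {a c : Fin 4} (h : a ≠ c) :
    transport p q (a, c) =
      min (excess q p c) (max (excess p q a - excess q p (evenNext a c)) 0) :=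
  if_neg h

/-- The three other indices can be listed in a cyclic order along which both marginals of a
transport plan unfold. -/
theorem exists_cyclic : ∀ a : Fin 4, ∃ x y z : Fin 4, a ≠ x ∧ a ≠ y ∧ a ≠ z ∧ x ≠ y ∧ x ≠ z ∧
    y ≠ z ∧ evenNext a x = y ∧ evenNext a y = z ∧ evenNext a z = x ∧
    evenNext x a = z ∧ evenNext z a = y ∧ evenNext y a = x := by
  decide +kernel

theorem sum_eq_of_ne {a x y z : Fin 4} (hax : a ≠ x) (hay : a ≠ y) (haz : a ≠ z) (hxy : x ≠ y)
    (hxz : x ≠ z) (hyz : y ≠ z) (F : Fin 4 → ℝ) : ∑ i, F i = F a + F x + F y + F z := by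
  have h : ({a, x, y, z} : Finset (Fin 4)) = Finset.univ := by
    apply Finset.eq_univ_of_card
    simp [Finset.card_insert_of_notMem, *]
  rw [← h, Finset.sum_insert (by simp [*]), Finset.sum_insert (by simp [*]),
    Finset.sum_insert (by simp [*]), Finset.sum_singleton]
  ring

theorem rowSum_transport {p q : Fin 4 → ℝ} (h : ∑ i, p i = ∑ i, q i) :
    rowSum (transport p q) = p := by
  have hs := sum_excess h
  have hm := fun i => mul_eq_zero.1 (excess_mul_excess p q i)
  have hp := excess_nonneg p q
  have hq := excess_nonneg q p
  funext a
  obtain ⟨x, y, z, hax, hay, haz, hxy, hxz, hyz, h1, h2, h3, -⟩ := exists_cyclic a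
  rw [rowSum, sum_eq_of_ne hax hay haz hxy hxz hyz, transport_self, transport_of_ne _ _ hax,
    transport_of_ne _ _ hay, transport_of_ne _ _ haz, h1, h2, h3]
  rw [sum_eq_of_ne hax hay haz hxy hxz hyz, sum_eq_of_ne hax hay haz hxy hxz hyz] at hs
  have key := row_identity (hp a) (hq x) (hq y) (hq z) (by
    rcases hm a with ha | ha
    · exact Or.inl ha
    have hle : excess p q a ≤ excess q p x + excess q p y + excess q p z := by
      linarith [hp x, hp y, hp z]
    rcases hm x with hx | hx
    · rcases hm y with hy | hy
      · rcases hm z with hz | hz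
        · right; left; linarith
        · exact Or.inr (Or.inr ⟨hle, Or.inr (Or.inr hz)⟩)
      · exact Or.inr (Or.inr ⟨hle, Or.inr (Or.inl hy)⟩)
    · exact Or.inr (Or.inr ⟨hle, Or.inl hx⟩))
  linarith [min_add_excess p q a]

theorem colSum_transport {p q : Fin 4 → ℝ} (h : ∑ i, p i = ∑ i, q i) :
    colSum (transport p q) = q := by
  have hs := sum_excess h
  have hm := fun i => mul_eq_zero.1 (excess_mul_excess p q i)
  have hp := excess_nonneg p q
  have hq := excess_nonneg q p
  funext a
  obtain ⟨x, y, z, hax, hay, haz, hxy, hxz, hyz, -, -, -, h1, h2, h3⟩ := exists_cyclic a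
  rw [colSum, sum_eq_of_ne hax hay haz hxy hxz hyz, transport_self, transport_of_ne _ _ hax.symm,
    transport_of_ne _ _ hay.symm, transport_of_ne _ _ haz.symm, h1, h2, h3]
  rw [sum_eq_of_ne hax hay haz hxy hxz hyz, sum_eq_of_ne hax hay haz hxy hxz hyz] at hs
  have key := col_identity (hq a) (hp x) (hp z) (hp y) (hq x) (hq z) (hq y) (hm x) (hm z) (hm y) (by
    rcases hm a with ha | ha
    · right; linarith
    · exact Or.inl ha)
  have := min_add_excess q p a
  rw [min_comm] at this
  linarith

theorem transport_nonneg {p q : Fin 4 → ℝ} (hp : ∀ i, 0 ≤ p i) (hq : ∀ i, 0 ≤ q i)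
    (v : Fin 4 × Fin 4) : 0 ≤ transport p q v := by
  unfold transport
  split_ifs
  · exact le_min (hp _) (hq _)
  · exact le_min (excess_nonneg _ _ _) (le_max_right _ _)

theorem excess_pos_of_transport_ne_zero {p q : Fin 4 → ℝ} {a c : Fin 4} (hac : a ≠ c)
    (h : transport p q (a, c) ≠ 0) :
    0 < excess q p c ∧ excess q p (evenNext a c) < excess p q a := by
  rw [transport_of_ne _ _ hac] at h
  constructor
  · refine (excess_nonneg q p c).lt_of_ne fun e => h ?_
    rw [← e, min_eq_left (le_max_right _ _)]
  · by_contra! hle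
    exact h (by rw [max_eq_right (by linarith), min_eq_right (excess_nonneg _ _ _)])

theorem evenNext_of_vandermonde_neg : ∀ a d b c : Fin 4, vandermonde a d b c < 0 →
    a ≠ b ∧ a ≠ c ∧ a ≠ d ∧ b ≠ c ∧ b ≠ d ∧ c ≠ d ∧ evenNext a d = c ∧ evenNext b c = d := by
  decide +kernel

theorem compatible_of_transport_ne_zero {p q : Fin 4 → ℝ} (h : ∑ i, p i = ∑ i, q i)
    {v w : Fin 4 × Fin 4} (hv : transport p q v ≠ 0) (hw : transport p q w ≠ 0) :
    Compatible v w := by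
  obtain ⟨a, d⟩ := v
  obtain ⟨b, c⟩ := w
  by_cases had : a = d
  · exact Or.inl had
  by_cases hbc : b = c
  · exact Or.inr (Or.inl hbc)
  obtain ⟨h1, h2⟩ := excess_pos_of_transport_ne_zero had hv
  obtain ⟨h3, h4⟩ := excess_pos_of_transport_ne_zero hbc hw
  have ha := (excess_nonneg q p _).trans_lt h2
  have hb := (excess_nonneg q p _).trans_lt h4
  have hm := excess_mul_excess p q
  refine Or.inr (Or.inr ⟨?_, ?_, ?_⟩)
  · rintro rfl
    exact (mul_pos hb h1).ne' (hm _)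
  · rintro rfl
    exact (mul_pos ha h3).ne' (hm _)
  · by_contra! hneg
    obtain ⟨hab, hac, -, -, hbd, hcd, e1, e2⟩ := evenNext_of_vandermonde_neg a d b c hneg
    rw [e1] at h2
    rw [e2] at h4
    have hs := sum_excess h
    rw [sum_eq_of_ne hab hac had hbc hbd hcd, sum_eq_of_ne hab hac had hbc hbd hcd] at hs
    have z1 := (mul_eq_zero.1 (hm c)).resolve_right h3.ne'
    have z2 := (mul_eq_zero.1 (hm d)).resolve_right h1.ne'
    have z3 := (mul_eq_zero.1 (hm a)).resolve_left ha.ne'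
    have z4 := (mul_eq_zero.1 (hm b)).resolve_left hb.ne'
    linarith

/-- Membership in the carrier in terms of admissibility of the support. -/
theorem mem_carrier_iff {f : Fin 4 × Fin 4 → ℝ} :
    f ∈ complex16.carrier ↔ (∀ v, 0 ≤ f v) ∧ ∑ v, f v = 1 ∧
      (∀ v w, f v ≠ 0 → f w ≠ 0 → Compatible v w) ∧ (∃ k, rowSum f k = 0) ∧
      ∃ l, colSum f l = 0 := by
  constructor
  · rintro ⟨h01, ⟨s, hs, hsf⟩, h1⟩
    obtain ⟨-, hc, ⟨k, hk⟩, l, hl⟩ := mem_complex16_faces.1 hs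
    have hmem : ∀ v, v ∈ s ↔ f v ≠ 0 := fun v => by
      rw [← Finset.mem_coe, hsf, Function.mem_support]
    refine ⟨fun v => (h01 v).1, h1, fun v w hv hw => hc v ((hmem v).2 hv) w ((hmem w).2 hw),
      ⟨k, Finset.sum_eq_zero fun j _ => ?_⟩, ⟨l, Finset.sum_eq_zero fun i _ => ?_⟩⟩
    · by_contra hne
      exact hk _ ((hmem _).2 hne) rfl
    · by_contra hne
      exact hl _ ((hmem _).2 hne) rfl
  · rintro ⟨h0, h1, hc, ⟨k, hk⟩, l, hl⟩
    have hmem : ∀ v, v ∈ Finset.univ.filter (fun v => f v ≠ 0) ↔ f v ≠ 0 := fun v => by simp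
    refine ⟨fun v => ⟨h0 v, h1 ▸ Finset.single_le_sum (fun w _ => h0 w) (Finset.mem_univ v)⟩,
      ⟨Finset.univ.filter fun v => f v ≠ 0, mem_complex16_faces.2 ⟨?_, ?_, ⟨k, ?_⟩, l, ?_⟩, ?_⟩, h1⟩
    · obtain ⟨v, -, hv⟩ := Finset.exists_ne_zero_of_sum_ne_zero (h1.trans_ne one_ne_zero)
      exact ⟨v, (hmem v).2 hv⟩
    · exact fun v hv w hw => hc v w ((hmem v).1 hv) ((hmem w).1 hw)
    · rintro ⟨i, j⟩ hv rfl
      exact (hmem _).1 hv ((Finset.sum_eq_zero_iff_of_nonneg fun _ _ => h0 _).1 hk j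
        (Finset.mem_univ _))
    · rintro ⟨i, j⟩ hv rfl
      exact (hmem _).1 hv ((Finset.sum_eq_zero_iff_of_nonneg fun _ _ => h0 _).1 hl i
        (Finset.mem_univ _))
    · ext v
      simp

theorem sum_rowSum (f : Fin 4 × Fin 4 → ℝ) : ∑ i, rowSum f i = ∑ v, f v :=
  (Fintype.sum_prod_type f).symm

theorem sum_colSum (f : Fin 4 × Fin 4 → ℝ) : ∑ j, colSum f j = ∑ v, f v :=
  (Fintype.sum_prod_type_right f).symm

theorem transport_mem_carrier {p q : Fin 4 → ℝ} (hp : p ∈ tetrahedronBoundary)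
    (hq : q ∈ tetrahedronBoundary) : transport p q ∈ complex16.carrier := by
  have h : ∑ i, p i = ∑ i, q i := hp.2.1.trans hq.2.1.symm
  rw [mem_carrier_iff, ← sum_rowSum, rowSum_transport h, colSum_transport h]
  exact ⟨transport_nonneg hp.1 hq.1, hp.2.1,
    fun v w => compatible_of_transport_ne_zero h, hp.2.2, hq.2.2⟩

theorem rowSum_mem {f : Fin 4 × Fin 4 → ℝ} (hf : f ∈ complex16.carrier) :
    rowSum f ∈ tetrahedronBoundary := by
  obtain ⟨h0, h1, -, hk, -⟩ := mem_carrier_iff.1 hf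
  exact ⟨fun i => Finset.sum_nonneg fun _ _ => h0 _, (sum_rowSum f).trans h1, hk⟩

theorem colSum_mem {f : Fin 4 × Fin 4 → ℝ} (hf : f ∈ complex16.carrier) :
    colSum f ∈ tetrahedronBoundary := by
  obtain ⟨h0, h1, -, -, hl⟩ := mem_carrier_iff.1 hf
  exact ⟨fun i => Finset.sum_nonneg fun _ _ => h0 _, (sum_colSum f).trans h1, hl⟩

theorem not_compatible_of_snd_eq_fst : ∀ a b c : Fin 4, a ≠ b → b ≠ c →
    ¬Compatible (a, b) (b, c) := by
  decide +kernel

/-- For compatible supports, the mass at an index either only leaves or only enters. -/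
theorem excess_eq_sum {f : Fin 4 × Fin 4 → ℝ} (h0 : ∀ v, 0 ≤ f v)
    (hc : ∀ v w, f v ≠ 0 → f w ≠ 0 → Compatible v w) {a x y z : Fin 4} (hax : a ≠ x) (hay : a ≠ y)
    (haz : a ≠ z) (hxy : x ≠ y) (hxz : x ≠ z) (hyz : y ≠ z) :
    min (rowSum f a) (colSum f a) = f (a, a) ∧
    excess (rowSum f) (colSum f) a = f (a, x) + f (a, y) + f (a, z) ∧
      excess (colSum f) (rowSum f) a = f (x, a) + f (y, a) + f (z, a) := by
  have hr : rowSum f a = f (a, a) + f (a, x) + f (a, y) + f (a, z) :=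
    sum_eq_of_ne hax hay haz hxy hxz hyz _
  have hl : colSum f a = f (a, a) + f (x, a) + f (y, a) + f (z, a) :=
    sum_eq_of_ne hax hay haz hxy hxz hyz fun i => f (i, a)
  have hzero : ∀ i j, a ≠ i → a ≠ j → f (a, i) = 0 ∨ f (j, a) = 0 := by
    intro i j hi hj
    by_contra! hne
    exact not_compatible_of_snd_eq_fst j a i hj.symm hi (hc _ _ hne.2 hne.1)
  have hcase : f (a, x) + f (a, y) + f (a, z) = 0 ∨ f (x, a) + f (y, a) + f (z, a) = 0 := by
    by_contra! hne
    have h1 : ∃ i, a ≠ i ∧ f (a, i) ≠ 0 := by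
      by_contra! hall
      exact hne.1 (by rw [hall x hax, hall y hay, hall z haz]; ring)
    have h2 : ∃ i, a ≠ i ∧ f (i, a) ≠ 0 := by
      by_contra! hall
      exact hne.2 (by rw [hall x hax, hall y hay, hall z haz]; ring)
    obtain ⟨i, hi, hi'⟩ := h1
    obtain ⟨j, hj, hj'⟩ := h2
    exact (hzero i j hi hj).elim hi' hj'
  have := h0 (a, x)
  have := h0 (a, y)
  have := h0 (a, z)
  have := h0 (x, a)
  have := h0 (y, a)
  have := h0 (z, a)
  unfold excess
  rw [hr, hl]
  rcases hcase with h | h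
  · rw [min_eq_left (by linarith), max_eq_right (by linarith), max_eq_left (by linarith)]
    refine ⟨?_, ?_, ?_⟩ <;> linarith
  · rw [min_eq_right (by linarith), max_eq_left (by linarith), max_eq_right (by linarith)]
    refine ⟨?_, ?_, ?_⟩ <;> linarith

/-- The incompatibilities which determine the mass transported from `a` to `c`. -/
theorem exists_evenNext : ∀ a c : Fin 4, a ≠ c → ∃ b d : Fin 4, evenNext a c = b ∧ a ≠ b ∧ a ≠ d ∧
    b ≠ c ∧ b ≠ d ∧ c ≠ d ∧ ¬Compatible (a, c) (c, b) ∧ ¬Compatible (a, c) (d, b) ∧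
    ¬Compatible (a, d) (b, c) ∧ ¬Compatible (a, d) (d, c) := by
  decide +kernel

/-- A point of the carrier is determined by its marginals. -/
theorem eq_transport {f : Fin 4 × Fin 4 → ℝ} (hf : f ∈ complex16.carrier) :
    transport (rowSum f) (colSum f) = f := by
  obtain ⟨h0, -, hc, -⟩ := mem_carrier_iff.1 hf
  have hz : ∀ v w, ¬Compatible v w → f v = 0 ∨ f w = 0 := by
    intro v w hvw
    by_contra! hne
    exact hvw (hc v w hne.1 hne.2)
  funext ⟨a, c⟩
  rcases eq_or_ne a c with rfl | hac
  · obtain ⟨x, y, z, hax, hay, haz, hxy, hxz, hyz, -⟩ := exists_cyclic a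
    rw [transport_self]
    exact (excess_eq_sum h0 hc hax hay haz hxy hxz hyz).1
  · obtain ⟨b, d, hb, hab, had, hbc, hbd, hcd, n1, n2, n3, n4⟩ := exists_evenNext a c hac
    rw [transport_of_ne _ _ hac, hb, (excess_eq_sum h0 hc hac hab had hbc.symm hcd hbd).2.1,
      (excess_eq_sum h0 hc hac.symm hbc.symm hcd hab had hbd).2.2,
      (excess_eq_sum h0 hc hab.symm hbc hbd hac had hcd).2.2]
    have := h0 (a, c)
    have := h0 (a, b)
    have := h0 (a, d)
    have := h0 (b, c)
    have := h0 (d, c)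
    have := h0 (c, b)
    have := h0 (d, b)
    have had0 : f (a, d) = 0 ∨ f (b, c) = 0 ∧ f (d, c) = 0 := by
      rcases hz _ _ n3 with e3 | e3
      · exact Or.inl e3
      · exact (hz _ _ n4).imp_right fun e4 => ⟨e3, e4⟩
    rcases eq_or_ne (f (a, c)) 0 with e | e
    · rcases had0 with e3 | ⟨e3, e4⟩
      · rw [max_eq_right (by linarith), min_eq_right (by linarith), e]
      · rw [min_eq_left (le_max_of_le_right (by linarith))]
        linarith
    · have e1 := (hz _ _ n1).resolve_left e
      have e2 := (hz _ _ n2).resolve_left e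
      rw [max_eq_left (by linarith)]
      rcases had0 with e3 | ⟨e3, e4⟩
      · rw [min_eq_right (by linarith)]
        linarith
      · rw [min_eq_left (by linarith)]
        linarith

/-! ### The carrier of `ℂP²₁₀` as a quotient of the carrier of `(S² × S²)₁₆` -/

open Classical in
/-- The map of carriers induced by the quotient map on the vertices: the value at an orbit is the
sum of the values at its elements. -/
noncomputable def fold (f : Fin 4 × Fin 4 → ℝ) (o : CP2Vertex) : ℝ :=
  ∑ v with orbitOf v = o, f v

theorem continuous_fold : Continuous fold := by
  unfold fold
  fun_prop

theorem fold_comp_flip (f : Fin 4 × Fin 4 → ℝ) : fold (f ∘ flip) = fold f := by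
  classical
  funext o
  refine Finset.sum_equiv flip (fun v => ?_) (fun v _ => rfl)
  simp [orbitOf_flip]

theorem fold_orbitOf (f : Fin 4 × Fin 4 → ℝ) {v : Fin 4 × Fin 4} (hv : v.1 ≠ v.2) :
    fold f (orbitOf v) = f v + f (flip v) := by
  classical
  have h : (Finset.univ.filter fun w => orbitOf w = orbitOf v) = {v, flip v} := by
    ext w
    simp [orbitOf_eq_iff]
  have hne : v ≠ flip v := fun e => hv (congrArg Prod.fst e)
  rw [fold, h, Finset.sum_pair hne]

theorem fold_orbitOf_diag (f : Fin 4 × Fin 4 → ℝ) {v : Fin 4 × Fin 4} (hv : v.1 = v.2) :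
    fold f (orbitOf v) = f v := by
  classical
  have hf : flip v = v := Prod.ext hv.symm hv
  have h : (Finset.univ.filter fun w => orbitOf w = orbitOf v) = {v} := by
    ext w
    simp [orbitOf_eq_iff, hf]
  rw [fold, h, Finset.sum_singleton]

theorem sum_fold (f : Fin 4 × Fin 4 → ℝ) : ∑ o, fold f o = ∑ v, f v := by
  classical
  exact Finset.sum_fiberwise _ _ _

theorem fold_nonneg {f : Fin 4 × Fin 4 → ℝ} (h0 : ∀ v, 0 ≤ f v) (o : CP2Vertex) : 0 ≤ fold f o :=
  Finset.sum_nonneg fun v _ => h0 v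

theorem fold_mem_carrier {f : Fin 4 × Fin 4 → ℝ} (hf : f ∈ complex16.carrier) :
    fold f ∈ complexCP2.carrier := by
  classical
  obtain ⟨h01, ⟨s, hs, hsf⟩, h1⟩ := hf
  have h0 := fun v => (h01 v).1
  have h1' : ∑ o, fold f o = 1 := (sum_fold f).trans h1
  refine ⟨fun o => ⟨fold_nonneg h0 o, h1' ▸ Finset.single_le_sum (fun o _ => fold_nonneg h0 o)
    (Finset.mem_univ o)⟩, ⟨s.image orbitOf, ?_, ?_⟩, h1'⟩
  · obtain ⟨hne, hs⟩ := mem_complex16_faces.1 hs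
    exact mem_complexCP2_faces.2 ⟨s, hne, hs, by congr⟩
  · ext o
    rw [Function.mem_support, fold, Ne, Finset.sum_eq_zero_iff_of_nonneg fun v _ => h0 v]
    have hmem : ∀ v, v ∈ s ↔ f v ≠ 0 := fun v => by
      rw [← Finset.mem_coe, hsf, Function.mem_support]
    simp only [Finset.coe_image, Set.mem_image, Finset.mem_coe, hmem, Finset.mem_filter,
      Finset.mem_univ, true_and, not_forall, exists_prop]
    exact exists_congr fun v => and_comm

theorem not_compatible_flip : ∀ v : Fin 4 × Fin 4, v.1 ≠ v.2 → ¬Compatible v (flip v) := by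
  decide +kernel

/-- The simplices of `(S² × S²)₁₆` are mapped injectively, so points of the carrier of `ℂP²₁₀` can
be lifted. -/
theorem fold_surjOn {g : CP2Vertex → ℝ} (hg : g ∈ complexCP2.carrier) :
    ∃ f ∈ complex16.carrier, fold f = g := by
  classical
  obtain ⟨h01, ⟨t, ht, htg⟩, h1⟩ := hg
  obtain ⟨s, hne, hs, rfl⟩ := mem_complexCP2_faces.1 ht
  have hfold : fold (fun v => if v ∈ s then g (orbitOf v) else 0) = g := by
    funext o
    obtain ⟨v, rfl⟩ := orbitOf_surjective o
    by_cases hv : orbitOf v ∈ s.image orbitOf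
    · obtain ⟨w, hw, hwv⟩ := Finset.mem_image.1 hv
      rw [← hwv]
      by_cases hd : w.1 = w.2
      · rw [fold_orbitOf_diag _ hd, if_pos hw]
      · rw [fold_orbitOf _ hd, if_pos hw, if_neg, add_zero]
        exact fun hw' => not_compatible_flip w hd (hs.1 w hw _ hw')
    · have hgv : g (orbitOf v) = 0 := by
        by_contra hne
        exact hv (Finset.mem_coe.1 (htg ▸ hne))
      rw [hgv]
      refine Finset.sum_eq_zero fun w hw => if_neg fun hws => hv ?_
      rw [← (Finset.mem_filter.1 hw).2]
      exact Finset.mem_image_of_mem _ hws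
  refine ⟨_, ⟨?_, ⟨s, mem_complex16_faces.2 ⟨hne, hs⟩, ?_⟩, ?_⟩, hfold⟩
  · intro v
    split_ifs
    · exact h01 _
    · exact ⟨le_rfl, zero_le_one⟩
  · ext v
    have hgs : v ∈ s → g (orbitOf v) ≠ 0 := fun hv =>
      htg.subset (Finset.mem_coe.2 (Finset.mem_image_of_mem _ hv))
    simpa using hgs
  · rw [← sum_fold, hfold, h1]

theorem flip_of_compatible : ∀ v w : Fin 4 × Fin 4, v.1 ≠ v.2 → w.1 ≠ w.2 → Compatible v w →
    ¬Compatible v (flip w) := by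
  decide +kernel

/-- An off-diagonal vertex in the supports of both `f` and `f'` fixes the orientation of all the
other off-diagonal vertices in these supports. -/
theorem eq_of_fold_eq_of_ne_zero {f f' : Fin 4 × Fin 4 → ℝ}
    (hc : ∀ v w, f v ≠ 0 → f w ≠ 0 → Compatible v w)
    (hc' : ∀ v w, f' v ≠ 0 → f' w ≠ 0 → Compatible v w)
    (h : fold f = fold f') {v : Fin 4 × Fin 4} (hd : v.1 ≠ v.2) (hv : f v ≠ 0) (hv' : f' v ≠ 0) :
    f = f' := by
  funext w
  have hw := congrFun h (orbitOf w)
  by_cases hwd : w.1 = w.2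
  · rwa [fold_orbitOf_diag _ hwd, fold_orbitOf_diag _ hwd] at hw
  rw [fold_orbitOf _ hwd, fold_orbitOf _ hwd] at hw
  by_cases hvw : Compatible v w
  · have hn := flip_of_compatible v w hd hwd hvw
    have e : f (flip w) = 0 := by_contra fun e => hn (hc _ _ hv e)
    have e' : f' (flip w) = 0 := by_contra fun e => hn (hc' _ _ hv' e)
    rwa [e, e', add_zero, add_zero] at hw
  · have e : f w = 0 := by_contra fun e => hvw (hc _ _ hv e)
    have e' : f' w = 0 := by_contra fun e => hvw (hc' _ _ hv' e)
    rw [e, e']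

theorem fold_eq_fold_iff {f f' : Fin 4 × Fin 4 → ℝ} (hf : f ∈ complex16.carrier)
    (hf' : f' ∈ complex16.carrier) : fold f = fold f' ↔ f = f' ∨ f = f' ∘ flip := by
  constructor
  · intro h
    obtain ⟨h0, -, hc, -⟩ := mem_carrier_iff.1 hf
    obtain ⟨h0', -, hc', -⟩ := mem_carrier_iff.1 hf'
    by_cases hall : ∀ v : Fin 4 × Fin 4, v.1 ≠ v.2 → f v = 0
    · left
      funext v
      have hv := congrFun h (orbitOf v)
      by_cases hd : v.1 = v.2
      · rwa [fold_orbitOf_diag _ hd, fold_orbitOf_diag _ hd] at hv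
      · rw [fold_orbitOf _ hd, fold_orbitOf _ hd, hall v hd, hall (flip v) (Ne.symm hd)] at hv
        rw [hall v hd]
        linarith [h0' v, h0' (flip v)]
    · push Not at hall
      obtain ⟨v, hd, hv⟩ := hall
      have hvv := congrFun h (orbitOf v)
      rw [fold_orbitOf _ hd, fold_orbitOf _ hd] at hvv
      by_cases hv' : f' v = 0
      · right
        have hv'' : f' (flip v) ≠ 0 := by
          intro e
          rw [hv', e] at hvv
          exact hv (by linarith [h0 v, h0 (flip v)])
        exact eq_of_fold_eq_of_ne_zero hc
          (fun x y hx hy => compatible_flip _ _ (hc' _ _ hx hy))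
          (h.trans (fold_comp_flip f').symm) hd hv hv''
      · exact Or.inl (eq_of_fold_eq_of_ne_zero hc hc' h hd hv hv')
  · rintro (rfl | rfl)
    · rfl
    · exact fold_comp_flip f'

theorem rowSum_comp_flip (f : Fin 4 × Fin 4 → ℝ) : rowSum (f ∘ flip) = colSum f := rfl

theorem colSum_comp_flip (f : Fin 4 × Fin 4 → ℝ) : colSum (f ∘ flip) = rowSum f := rfl

theorem transport_eq_transport_iff {p q p' q' : Fin 4 → ℝ} (h : ∑ i, p i = ∑ i, q i)
    (h' : ∑ i, p' i = ∑ i, q' i) : transport p q = transport p' q' ↔ p = p' ∧ q = q' := by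
  refine ⟨fun e => ?_, by rintro ⟨rfl, rfl⟩; rfl⟩
  have e1 := congrArg rowSum e
  have e2 := congrArg colSum e
  rw [rowSum_transport h, rowSum_transport h'] at e1
  rw [colSum_transport h, colSum_transport h'] at e2
  exact ⟨e1, e2⟩

theorem fold_transport_eq_iff {p q p' q' : Fin 4 → ℝ} (hp : p ∈ tetrahedronBoundary)
    (hq : q ∈ tetrahedronBoundary) (hp' : p' ∈ tetrahedronBoundary)
    (hq' : q' ∈ tetrahedronBoundary) :
    fold (transport p q) = fold (transport p' q') ↔ p = p' ∧ q = q' ∨ p = q' ∧ q = p' := by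
  have h : ∑ i, p i = ∑ i, q i := hp.2.1.trans hq.2.1.symm
  have h' : ∑ i, p' i = ∑ i, q' i := hp'.2.1.trans hq'.2.1.symm
  have hflip : transport p' q' ∘ flip = transport q' p' := by
    have hmem : transport p' q' ∘ flip ∈ complex16.carrier := by
      obtain ⟨h0, h1, hc, hk, hl⟩ := mem_carrier_iff.1 (transport_mem_carrier hp' hq')
      exact mem_carrier_iff.2 ⟨fun v => h0 _, (Equiv.sum_comp flip _).trans h1,
        fun v w hv hw => compatible_flip _ _ (hc _ _ hv hw), hl, hk⟩
    rw [← eq_transport hmem, rowSum_comp_flip, colSum_comp_flip, rowSum_transport h',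
      colSum_transport h']
  rw [fold_eq_fold_iff (transport_mem_carrier hp hq) (transport_mem_carrier hp' hq'), hflip]
  exact or_congr (transport_eq_transport_iff h h') (transport_eq_transport_iff h h'.symm)

theorem exists_fold_transport {g : CP2Vertex → ℝ} (hg : g ∈ complexCP2.carrier) :
    ∃ p ∈ tetrahedronBoundary, ∃ q ∈ tetrahedronBoundary, fold (transport p q) = g := by
  obtain ⟨f, hf, rfl⟩ := fold_surjOn hg
  exact ⟨_, rowSum_mem hf, _, colSum_mem hf, by rw [eq_transport hf]⟩

/-! ### The boundary of the tetrahedron as the space of rays of a three-dimensional space -/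

/-- The minimal coordinate of a vector. -/
noncomputable def minCoord (a : Fin 4 → ℝ) : ℝ := min (min (a 0) (a 1)) (min (a 2) (a 3))

theorem minCoord_le (a : Fin 4 → ℝ) (i : Fin 4) : minCoord a ≤ a i := by
  fin_cases i <;> simp [minCoord]

theorem exists_eq_minCoord (a : Fin 4 → ℝ) : ∃ i, a i = minCoord a := by
  unfold minCoord
  rcases min_choice (min (a 0) (a 1)) (min (a 2) (a 3)) with h | h <;> rw [h]
  · rcases min_choice (a 0) (a 1) with h | h <;> exact ⟨_, h.symm⟩
  · rcases min_choice (a 2) (a 3) with h | h <;> exact ⟨_, h.symm⟩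

theorem minCoord_smul {s : ℝ} (hs : 0 ≤ s) (a : Fin 4 → ℝ) :
    minCoord (s • a) = s * minCoord a := by
  simp [minCoord, mul_min_of_nonneg _ _ hs]

theorem minCoord_neg {a : Fin 4 → ℝ} (hsum : ∑ i, a i = 0) (ha : a ≠ 0) : minCoord a < 0 := by
  by_contra! h
  have h0 : ∀ i, 0 ≤ a i := fun i => h.trans (minCoord_le a i)
  exact ha (funext fun i =>
    (Finset.sum_eq_zero_iff_of_nonneg fun i _ => h0 i).1 hsum i (Finset.mem_univ i))

/-- The point of the boundary of the tetrahedron on the ray spanned by a nonzero vector `a` with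
coordinate sum zero, where the barycentre of the tetrahedron is the origin. -/
noncomputable def rayPoint (a : Fin 4 → ℝ) (i : Fin 4) : ℝ :=
  (a i - minCoord a) / (-4 * minCoord a)

theorem rayPoint_mem {a : Fin 4 → ℝ} (hsum : ∑ i, a i = 0) (ha : a ≠ 0) :
    rayPoint a ∈ tetrahedronBoundary := by
  have hm := minCoord_neg hsum ha
  refine ⟨fun i => div_nonneg (sub_nonneg.2 (minCoord_le a i)) (by linarith), ?_, ?_⟩
  · simp only [rayPoint]
    rw [← Finset.sum_div, Finset.sum_sub_distrib, hsum, div_eq_one_iff_eq (by linarith)]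
    simp
  · obtain ⟨i, hi⟩ := exists_eq_minCoord a
    exact ⟨i, by rw [rayPoint, hi, sub_self, zero_div]⟩

theorem rayPoint_smul {s : ℝ} (hs : 0 < s) (a : Fin 4 → ℝ) : rayPoint (s • a) = rayPoint a := by
  funext i
  rw [rayPoint, rayPoint, minCoord_smul hs.le, Pi.smul_apply, smul_eq_mul, ← mul_sub,
    mul_left_comm, mul_div_mul_left _ _ hs.ne']

theorem exists_smul_of_rayPoint_eq {a b : Fin 4 → ℝ} (hsa : ∑ i, a i = 0) (ha : a ≠ 0)
    (hsb : ∑ i, b i = 0) (hb : b ≠ 0) (h : rayPoint a = rayPoint b) :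
    ∃ s : ℝ, 0 < s ∧ b = s • a := by
  have hma := minCoord_neg hsa ha
  have hmb := minCoord_neg hsb hb
  refine ⟨minCoord b / minCoord a, div_pos_of_neg_of_neg hmb hma, funext fun i => ?_⟩
  have hi := congrFun h i
  rw [rayPoint, rayPoint, div_eq_div_iff (by linarith) (by linarith)] at hi
  rw [Pi.smul_apply, smul_eq_mul, div_mul_eq_mul_div, eq_div_iff hma.ne]
  linarith

theorem rayPoint_sub_barycentre {p : Fin 4 → ℝ} (hp : p ∈ tetrahedronBoundary) :
    rayPoint (fun i => p i - 1 / 4) = p := by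
  obtain ⟨h0, -, k, hk⟩ := hp
  have hm : minCoord (fun i => p i - 1 / 4) = -(1 / 4) := by
    apply le_antisymm
    · have := minCoord_le (fun i => p i - 1 / 4) k
      simp only [hk] at this
      linarith
    · obtain ⟨i, hi⟩ := exists_eq_minCoord (fun i => p i - 1 / 4)
      rw [← hi]
      linarith [h0 i]
  funext i
  rw [rayPoint, hm]
  ring

theorem continuousOn_rayPoint : ContinuousOn rayPoint {a | minCoord a ≠ 0} := by
  have hc : Continuous minCoord := by unfold minCoord; fun_prop
  refine continuousOn_pi.2 fun i => ContinuousOn.div ?_ ?_ fun a ha => ?_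
  · fun_prop
  · fun_prop
  · exact mul_ne_zero (by norm_num) ha

/-! ### The Hopf map to the boundary of the tetrahedron -/

/-- The Hopf vector of a pair of complex numbers, in coordinates in which the four vertices
`(1, 1, 1)`, `(1, -1, -1)`, `(-1, 1, -1)`, `(-1, -1, 1)` of a regular tetrahedron in `ℝ³` become
the linear functionals that are read off. -/
noncomputable def hopfVector (u : ℂ × ℂ) : Fin 4 → ℝ :=
  let x := Complex.normSq u.1 - Complex.normSq u.2
  let y := 2 * (u.1.re * u.2.re + u.1.im * u.2.im)
  let z := 2 * (u.1.re * u.2.im - u.1.im * u.2.re)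
  ![x + y + z, x - y - z, -x + y - z, -x - y + z]

theorem continuous_hopfVector : Continuous hopfVector := by
  unfold hopfVector
  refine continuous_pi fun i => ?_
  have h1 : Continuous fun u : ℂ × ℂ => Complex.normSq u.1 :=
    Complex.continuous_normSq.comp continuous_fst
  have h2 : Continuous fun u : ℂ × ℂ => Complex.normSq u.2 :=
    Complex.continuous_normSq.comp continuous_snd
  fin_cases i <;> simp <;> fun_prop

theorem sum_hopfVector (u : ℂ × ℂ) : ∑ i, hopfVector u i = 0 := by
  simp [hopfVector, Fin.sum_univ_four]
  ring

/-- Two pairs of complex numbers are parallel if they represent the same point of the complex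
projective line. -/
def Parallel (u v : ℂ × ℂ) : Prop := u.1 * v.2 = u.2 * v.1

theorem Parallel.exists_smul {u v : ℂ × ℂ} (hu : u ≠ 0) (hv : v ≠ 0) (h : Parallel u v) :
    ∃ c : ℂ, c ≠ 0 ∧ v = c • u := by
  obtain ⟨c, hc⟩ : ∃ c : ℂ, v = c • u := by
    unfold Parallel at h
    by_cases h1 : u.1 = 0
    · have h2 : u.2 ≠ 0 := fun h2 => hu (Prod.ext h1 h2)
      refine ⟨v.2 / u.2, Prod.ext ?_ ?_⟩
      · rw [h1, zero_mul, eq_comm, mul_eq_zero] at h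
        simp [h1, h.resolve_left h2]
      · simp [h2]
    · refine ⟨v.1 / u.1, Prod.ext ?_ ?_⟩
      · simp [h1]
      · simp only [Prod.smul_snd, smul_eq_mul]
        field_simp
        linear_combination h
  exact ⟨c, fun h0 => hv (by rw [hc, h0, zero_smul]), hc⟩

theorem hopfVector_smul (c : ℂ) (u : ℂ × ℂ) :
    hopfVector (c • u) = Complex.normSq c • hopfVector u := by
  funext i
  fin_cases i <;> simp [hopfVector, Complex.normSq_apply] <;> ring

/-- The Hopf vector has squared length `4 (|u₁|² + |u₂|²)²`. -/
theorem sum_hopfVector_sq (u : ℂ × ℂ) :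
    ∑ i, hopfVector u i ^ 2 = 4 * (Complex.normSq u.1 + Complex.normSq u.2) ^ 2 := by
  simp [hopfVector, Fin.sum_univ_four, Complex.normSq_apply]
  ring

/-- The inner product of two Hopf vectors measures the deviation from parallelism. -/
theorem sum_hopfVector_mul (u v : ℂ × ℂ) :
    ∑ i, hopfVector u i * hopfVector v i =
      4 * ((Complex.normSq u.1 + Complex.normSq u.2) * (Complex.normSq v.1 + Complex.normSq v.2) -
        2 * Complex.normSq (u.1 * v.2 - u.2 * v.1)) := by
  simp [hopfVector, Fin.sum_univ_four, Complex.normSq_apply]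
  ring

theorem normSq_add_normSq_pos {u : ℂ × ℂ} (hu : u ≠ 0) :
    0 < Complex.normSq u.1 + Complex.normSq u.2 := by
  by_contra! h
  have h1 := Complex.normSq_nonneg u.1
  have h2 := Complex.normSq_nonneg u.2
  exact hu (Prod.ext (Complex.normSq_eq_zero.1 (by linarith))
    (Complex.normSq_eq_zero.1 (by linarith)))

theorem hopfVector_ne_zero {u : ℂ × ℂ} (hu : u ≠ 0) : hopfVector u ≠ 0 := by
  intro h
  have h2 := sum_hopfVector_sq u
  rw [h] at h2
  have := normSq_add_normSq_pos hu
  simp at h2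
  nlinarith

theorem parallel_of_hopfVector_eq_smul {u v : ℂ × ℂ} {s : ℝ} (hs : 0 < s)
    (h : hopfVector v = s • hopfVector u) : Parallel u v := by
  have hu := sum_hopfVector_sq u
  have hv := sum_hopfVector_sq v
  have huv := sum_hopfVector_mul u v
  have e1 : ∑ i, hopfVector v i ^ 2 = s ^ 2 * ∑ i, hopfVector u i ^ 2 := by
    rw [h, Finset.mul_sum]
    exact Finset.sum_congr rfl fun i _ => by simp; ring
  have e2 : ∑ i, hopfVector u i * hopfVector v i = s * ∑ i, hopfVector u i ^ 2 := by
    rw [h, Finset.mul_sum]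
    exact Finset.sum_congr rfl fun i _ => by simp; ring
  have nu := add_nonneg (Complex.normSq_nonneg u.1) (Complex.normSq_nonneg u.2)
  have nv := add_nonneg (Complex.normSq_nonneg v.1) (Complex.normSq_nonneg v.2)
  set N := Complex.normSq u.1 + Complex.normSq u.2
  set N' := Complex.normSq v.1 + Complex.normSq v.2
  have hN : N' = s * N := by
    refine (sq_eq_sq₀ nv (mul_nonneg hs.le nu)).1 ?_
    rw [e1, hu] at hv
    linarith
  have h0 : Complex.normSq (u.1 * v.2 - u.2 * v.1) = 0 := by
    rw [e2, hu, hN] at huv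
    linarith
  exact sub_eq_zero.1 (Complex.normSq_eq_zero.1 h0)

/-- The Hopf map, with the boundary of the tetrahedron as the model of the 2-sphere. -/
noncomputable def hopf (u : ℂ × ℂ) : Fin 4 → ℝ := rayPoint (hopfVector u)

theorem hopf_mem {u : ℂ × ℂ} (hu : u ≠ 0) : hopf u ∈ tetrahedronBoundary :=
  rayPoint_mem (sum_hopfVector u) (hopfVector_ne_zero hu)

theorem hopf_smul {c : ℂ} (hc : c ≠ 0) (u : ℂ × ℂ) : hopf (c • u) = hopf u := by
  rw [hopf, hopfVector_smul, rayPoint_smul (Complex.normSq_pos.2 hc), hopf]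

theorem hopf_eq_hopf_iff {u v : ℂ × ℂ} (hu : u ≠ 0) (hv : v ≠ 0) :
    hopf u = hopf v ↔ Parallel u v := by
  constructor
  · intro h
    obtain ⟨s, hs, e⟩ := exists_smul_of_rayPoint_eq (sum_hopfVector u) (hopfVector_ne_zero hu)
      (sum_hopfVector v) (hopfVector_ne_zero hv) h
    exact parallel_of_hopfVector_eq_smul hs e
  · intro h
    obtain ⟨c, hc, rfl⟩ := h.exists_smul hu hv
    exact (hopf_smul hc u).symm

/-- Every nonzero vector of `ℝ³`, given by four coordinates with sum zero, is a positive multiple of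
a Hopf vector. -/
theorem exists_hopfVector_eq_smul {a : Fin 4 → ℝ} (hsum : ∑ i, a i = 0) (ha : a ≠ 0) :
    ∃ u : ℂ × ℂ, u ≠ 0 ∧ ∃ s : ℝ, 0 < s ∧ hopfVector u = s • a := by
  obtain ⟨x, y, z, rfl⟩ : ∃ x y z : ℝ, a = ![x + y + z, x - y - z, -x + y - z, -x - y + z] := by
    rw [Fin.sum_univ_four] at hsum
    refine ⟨(a 0 + a 1) / 2, (a 0 + a 2) / 2, (a 0 + a 3) / 2, funext fun i => ?_⟩
    fin_cases i <;> simp <;> linarith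
  have hN2 := Real.sq_sqrt (by positivity : 0 ≤ x ^ 2 + y ^ 2 + z ^ 2)
  have hN0 := Real.sqrt_nonneg (x ^ 2 + y ^ 2 + z ^ 2)
  set N := Real.sqrt (x ^ 2 + y ^ 2 + z ^ 2)
  have hNx : 0 ≤ N + x := by
    have := (abs_le_of_sq_le_sq (a := x) (b := N) (by nlinarith) hN0)
    linarith [neg_abs_le x]
  rcases hNx.eq_or_lt with h | h
  · -- the fibre over the point antipodal to `(1, 0, 0)`
    have hx : x = -N := by linarith
    have hyz : y ^ 2 + z ^ 2 = 0 := by rw [hx] at hN2; linarith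
    have hy : y = 0 := by nlinarith
    have hz : z = 0 := by nlinarith
    have hN : 0 < N := by
      refine hN0.lt_of_ne fun hN => ha ?_
      rw [hx, hy, hz, ← hN]
      funext i; fin_cases i <;> simp
    refine ⟨(0, 1), by simp, N⁻¹, inv_pos.2 hN, ?_⟩
    rw [hx, hy, hz]
    funext i
    fin_cases i <;> simp [hopfVector, hN.ne']
  · refine ⟨(((N + x : ℝ) : ℂ), ⟨y, z⟩), ?_, 2 * (N + x), by linarith, ?_⟩
    · intro e
      have := congrArg (fun u : ℂ × ℂ => u.1.re) e
      simp at this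
      linarith
    · funext i
      fin_cases i <;> simp [hopfVector, Complex.normSq_apply] <;> nlinarith

theorem exists_hopf_eq {p : Fin 4 → ℝ} (hp : p ∈ tetrahedronBoundary) :
    ∃ u : ℂ × ℂ, u ≠ 0 ∧ hopf u = p := by
  have hsum : ∑ i, (p i - 1 / 4) = 0 := by
    rw [Finset.sum_sub_distrib, hp.2.1]
    simp
  have hne : (fun i => p i - 1 / 4) ≠ 0 := by
    obtain ⟨k, hk⟩ := hp.2.2
    intro e
    have := congrFun e k
    simp only [hk, Pi.zero_apply] at this
    norm_num at this
  obtain ⟨u, hu, s, hs, e⟩ := exists_hopfVector_eq_smul hsum hne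
  exact ⟨u, hu, by rw [hopf, e, rayPoint_smul hs, rayPoint_sub_barycentre hp]⟩

theorem continuousOn_hopf : ContinuousOn hopf {u | u ≠ 0} :=
  continuousOn_rayPoint.comp continuous_hopfVector.continuousOn fun _ hu =>
    (minCoord_neg (sum_hopfVector _) (hopfVector_ne_zero hu)).ne

end S2xS2

/-! ### The complex projective plane as the symmetric square of the projective line -/

namespace ComplexProjectivePlane

/-- The coefficients of the product of two binary linear forms. -/
def symProd (u w : ℂ × ℂ) : Fin 3 → ℂ := ![u.1 * w.1, u.1 * w.2 + u.2 * w.1, u.2 * w.2]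

/-- The value at `t` of the product of the two linear forms vanishing at `u` and at `w`. -/
theorem symProd_eval (u w t : ℂ × ℂ) :
    symProd u w 0 * t.2 ^ 2 - symProd u w 1 * (t.1 * t.2) + symProd u w 2 * t.1 ^ 2 =
      (u.1 * t.2 - u.2 * t.1) * (w.1 * t.2 - w.2 * t.1) := by
  simp [symProd]
  ring

theorem symProd_ne_zero {u w : ℂ × ℂ} (hu : u ≠ 0) (hw : w ≠ 0) : symProd u w ≠ 0 := by
  intro h
  have h0 : u.1 * w.1 = 0 := congrFun h 0
  have h1 : u.1 * w.2 + u.2 * w.1 = 0 := congrFun h 1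
  have h2 : u.2 * w.2 = 0 := congrFun h 2
  rcases mul_eq_zero.1 h0 with e | e <;> rcases mul_eq_zero.1 h2 with e' | e'
  · exact hu (Prod.ext e e')
  · rw [e, e', zero_mul, zero_add, mul_eq_zero] at h1
    rcases h1 with h1 | h1
    · exact hu (Prod.ext e h1)
    · exact hw (Prod.ext h1 e')
  · rw [e, e', zero_mul, add_zero, mul_eq_zero] at h1
    rcases h1 with h1 | h1
    · exact hu (Prod.ext h1 e')
    · exact hw (Prod.ext e h1)
  · exact hw (Prod.ext e e')

theorem symProd_comm (u w : ℂ × ℂ) : symProd u w = symProd w u := by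
  funext i
  fin_cases i <;> simp [symProd] <;> ring

theorem symProd_smul_smul (c d : ℂ) (u w : ℂ × ℂ) :
    symProd (c • u) (d • w) = (c * d) • symProd u w := by
  funext i
  fin_cases i <;> simp [symProd] <;> ring

/-- The point of the complex projective plane given by an unordered pair of points of the
projective line. -/
noncomputable def symPoint (u w : {u : ℂ × ℂ // u ≠ 0}) : ComplexProjectivePlane :=
  Projectivization.mk ℂ (symProd u.1 w.1) (symProd_ne_zero u.2 w.2)

theorem symPoint_comm (u w : {u : ℂ × ℂ // u ≠ 0}) : symPoint u w = symPoint w u := by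
  simp only [symPoint, symProd_comm u.1 w.1]
  rfl

theorem continuous_symPoint :
    Continuous fun x : {u : ℂ × ℂ // u ≠ 0} × {u : ℂ × ℂ // u ≠ 0} => symPoint x.1 x.2 := by
  have h : Continuous fun x : {u : ℂ × ℂ // u ≠ 0} × {u : ℂ × ℂ // u ≠ 0} =>
      (⟨symProd x.1.1 x.2.1, symProd_ne_zero x.1.2 x.2.2⟩ : {v : Fin 3 → ℂ // v ≠ 0}) := by
    refine Continuous.subtype_mk (continuous_pi fun i => ?_) _
    fin_cases i <;> simp [symProd] <;> fun_prop
  exact continuous_coinduced_rng.comp h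

open S2xS2 in
theorem symPoint_eq_of_parallel {u w u' w' : {u : ℂ × ℂ // u ≠ 0}} (h1 : Parallel u.1 u'.1)
    (h2 : Parallel w.1 w'.1) : symPoint u w = symPoint u' w' := by
  obtain ⟨c, hc, e⟩ := h1.exists_smul u.2 u'.2
  obtain ⟨d, hd, e'⟩ := h2.exists_smul w.2 w'.2
  refine ((Projectivization.mk_eq_mk_iff' ℂ _ _ _ _).2 ⟨c * d, ?_⟩).symm
  rw [e, e', symProd_smul_smul]

open S2xS2 in
/-- A product of two linear forms determines the unordered pair of their zeros. -/
theorem symPoint_eq_iff (u w u' w' : {u : ℂ × ℂ // u ≠ 0}) :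
    symPoint u w = symPoint u' w' ↔
      Parallel u.1 u'.1 ∧ Parallel w.1 w'.1 ∨ Parallel u.1 w'.1 ∧ Parallel w.1 u'.1 := by
  constructor
  · intro h
    obtain ⟨a, ha⟩ := (Projectivization.mk_eq_mk_iff' ℂ _ _ _ _).1 h
    have ha0 : a ≠ 0 := by
      rintro rfl
      rw [zero_smul] at ha
      exact symProd_ne_zero u.2 w.2 ha.symm
    have key : ∀ t : ℂ × ℂ, (u.1.1 * t.2 - u.1.2 * t.1) * (w.1.1 * t.2 - w.1.2 * t.1) =
        a * ((u'.1.1 * t.2 - u'.1.2 * t.1) * (w'.1.1 * t.2 - w'.1.2 * t.1)) := by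
      intro t
      rw [← symProd_eval, ← symProd_eval, ← ha]
      simp only [Pi.smul_apply, smul_eq_mul]
      ring
    -- evaluate both forms at their zeros
    have k1 : Parallel u.1 u'.1 ∨ Parallel w.1 u'.1 := by
      have := key u'.1
      rw [show u'.1.1 * u'.1.2 - u'.1.2 * u'.1.1 = 0 by ring, zero_mul, mul_zero,
        mul_eq_zero] at this
      exact this.imp sub_eq_zero.1 sub_eq_zero.1
    have k2 : Parallel u.1 w'.1 ∨ Parallel w.1 w'.1 := by
      have := key w'.1
      rw [show w'.1.1 * w'.1.2 - w'.1.2 * w'.1.1 = 0 by ring, mul_zero, mul_zero,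
        mul_eq_zero] at this
      exact this.imp sub_eq_zero.1 sub_eq_zero.1
    have swap : ∀ x y : ℂ × ℂ, x.1 * y.2 - x.2 * y.1 = 0 → Parallel y x := fun x y h => by
      unfold Parallel
      linear_combination -h
    have k3 : Parallel u.1 u'.1 ∨ Parallel u.1 w'.1 := by
      have := key u.1
      rw [show u.1.1 * u.1.2 - u.1.2 * u.1.1 = 0 by ring, zero_mul, eq_comm, mul_eq_zero,
        or_iff_right ha0, mul_eq_zero] at this
      exact this.imp (swap _ _) (swap _ _)
    have k4 : Parallel w.1 u'.1 ∨ Parallel w.1 w'.1 := by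
      have := key w.1
      rw [show w.1.1 * w.1.2 - w.1.2 * w.1.1 = 0 by ring, mul_zero, eq_comm, mul_eq_zero,
        or_iff_right ha0, mul_eq_zero] at this
      exact this.imp (swap _ _) (swap _ _)
    tauto
  · rintro (⟨h1, h2⟩ | ⟨h1, h2⟩)
    · exact symPoint_eq_of_parallel h1 h2
    · rw [symPoint_comm u' w']
      exact symPoint_eq_of_parallel h1 h2

/-- Every binary quadratic form over `ℂ` is a product of linear forms. -/
theorem exists_symPoint_eq (x : ComplexProjectivePlane) : ∃ u w, symPoint u w = x := by
  induction x using Projectivization.ind with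
  | h v hv =>
  by_cases h0 : v 0 = 0
  · have hw : ((v 1, v 2) : ℂ × ℂ) ≠ 0 := by
      intro e
      rw [Prod.mk_eq_zero] at e
      refine hv (funext fun i => ?_)
      fin_cases i
      · exact h0
      · exact e.1
      · exact e.2
    refine ⟨⟨(0, 1), by simp⟩, ⟨_, hw⟩, (Projectivization.mk_eq_mk_iff' ℂ _ _ _ _).2 ⟨1, ?_⟩⟩
    funext i
    fin_cases i <;> simp [symProd, h0]
  · obtain ⟨δ, hδ⟩ := IsAlgClosed.exists_pow_nat_eq (v 1 ^ 2 - 4 * v 0 * v 2) two_pos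
    have h2 : (2 * v 0 : ℂ) ≠ 0 := mul_ne_zero two_ne_zero h0
    refine ⟨⟨(2 * v 0, v 1 + δ), fun e => h2 (congrArg Prod.fst e)⟩,
      ⟨(2 * v 0, v 1 - δ), fun e => h2 (congrArg Prod.fst e)⟩,
      (Projectivization.mk_eq_mk_iff' ℂ _ _ _ _).2 ⟨4 * v 0, ?_⟩⟩
    funext i
    fin_cases i <;> simp [symProd]
    · ring
    · ring
    · linear_combination hδ

/-- The entries of the orthogonal projection onto the line spanned by `v`. -/
noncomputable def projectionEntries (v : Fin 3 → ℂ) (ij : Fin 3 × Fin 3) : ℂ :=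
  v ij.1 * star (v ij.2) / ∑ k, v k * star (v k)

theorem sum_mul_star_ne_zero {v : Fin 3 → ℂ} (hv : v ≠ 0) : ∑ k, v k * star (v k) ≠ 0 := by
  have h : ∑ k, v k * star (v k) = ((∑ k, Complex.normSq (v k) : ℝ) : ℂ) := by
    rw [Complex.ofReal_sum]
    exact Finset.sum_congr rfl fun k _ => Complex.mul_conj (v k)
  rw [h, Complex.ofReal_ne_zero, Ne, Finset.sum_eq_zero_iff_of_nonneg fun _ _ =>
    Complex.normSq_nonneg _]
  intro h0
  exact hv (funext fun k => Complex.normSq_eq_zero.1 (h0 k (Finset.mem_univ k)))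

theorem projectionEntries_smul {c : ℂ} (hc : c ≠ 0) (v : Fin 3 → ℂ) :
    projectionEntries (c • v) = projectionEntries v := by
  funext ij
  have hc' : c * star c ≠ 0 := mul_ne_zero hc (star_ne_zero.2 hc)
  have h : ∀ i j, (c • v) i * star ((c • v) j) = c * star c * (v i * star (v j)) := by
    intro i j
    simp only [Pi.smul_apply, smul_eq_mul, star_mul']
    ring
  simp only [projectionEntries, h]
  rw [← Finset.mul_sum, mul_div_mul_left _ _ hc']

theorem exists_smul_of_projectionEntries_eq {v w : Fin 3 → ℂ} (hv : v ≠ 0) (hw : w ≠ 0)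
    (h : projectionEntries v = projectionEntries w) : ∃ a : ℂ, a • w = v := by
  obtain ⟨j, hj⟩ := Function.ne_iff.1 hv
  have hv' := sum_mul_star_ne_zero hv
  have hj' : star (v j) ≠ 0 := star_ne_zero.2 hj
  refine ⟨star (w j) / (∑ k, w k * star (w k)) * ((∑ k, v k * star (v k)) / star (v j)),
    funext fun i => ?_⟩
  have hi := congrFun h (i, j)
  simp only [projectionEntries] at hi
  rw [div_eq_iff hv'] at hi
  rw [Pi.smul_apply, smul_eq_mul]
  refine mul_right_cancel₀ hj' ?_
  rw [hi]
  have hw' := sum_mul_star_ne_zero hw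
  field_simp

/-- Sending a line to the orthogonal projection onto it embeds the complex projective plane into a
space of matrices. -/
instance : T2Space ComplexProjectivePlane := by
  let F : ComplexProjectivePlane → Fin 3 × Fin 3 → ℂ :=
    Projectivization.lift (fun v => projectionEntries v.1) (by
      rintro ⟨a, ha⟩ ⟨b, hb⟩ t h
      have ht : t ≠ 0 := by
        rintro rfl
        exact ha (by simpa using h)
      simp only at h ⊢
      rw [h, projectionEntries_smul ht])
  have hF : Function.Injective F := by
    intro x y h
    induction x using Projectivization.ind with
    | h v hv =>
    induction y using Projectivization.ind with
    | h w hw =>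
    exact (Projectivization.mk_eq_mk_iff' ℂ _ _ _ _).2 (exists_smul_of_projectionEntries_eq hv hw h)
  refine T2Space.of_injective_continuous hF (continuous_coinduced_dom.2 ?_)
  refine continuous_pi fun ij => ?_
  change Continuous fun v : {v : Fin 3 → ℂ // v ≠ 0} => projectionEntries v.1 ij
  unfold projectionEntries
  have hc : ∀ k, Continuous fun v : {v : Fin 3 → ℂ // v ≠ 0} => v.1 k :=
    fun k => (continuous_apply k).comp continuous_subtype_val
  exact Continuous.div ((hc _).mul (hc _).star)
    (continuous_finsetSum _ fun k _ => (hc k).mul (hc k).star) fun v => sum_mul_star_ne_zero v.2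

end ComplexProjectivePlane

/-! ### Comparison of the two quotients -/

/-- Two continuous surjections from a compact space to Hausdorff spaces with the same fibres have
homeomorphic targets. -/
theorem nonempty_homeomorph_of_fibers {X Y Z : Type*} [TopologicalSpace X] [TopologicalSpace Y]
    [TopologicalSpace Z] [CompactSpace X] [T2Space Y] [T2Space Z] {A : X → Y} {B : X → Z}
    (hA : Continuous A) (hB : Continuous B) (hA' : Function.Surjective A)
    (hB' : Function.Surjective B) (h : ∀ x y, A x = A y ↔ B x = B y) : Nonempty (Y ≃ₜ Z) := by
  have qA : Topology.IsQuotientMap A := hA.isClosedMap.isQuotientMap hA hA'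
  have qB : Topology.IsQuotientMap B := hB.isClosedMap.isQuotientMap hB hB'
  exact ⟨(qA.homeomorph (f := ⟨A, hA⟩)).symm.trans
    ((Homeomorph.Quotient.congrRight h).trans (qB.homeomorph (f := ⟨B, hB⟩)))⟩

namespace S2xS2

open ComplexProjectivePlane

theorem exists_sphere_smul {u : ℂ × ℂ} (hu : u ≠ 0) :
    ∃ c : ℂ, c ≠ 0 ∧ c • u ∈ Metric.sphere (0 : ℂ × ℂ) 1 := by
  refine ⟨((‖u‖⁻¹ : ℝ) : ℂ), by simpa using hu, ?_⟩
  rw [mem_sphere_zero_iff_norm, norm_smul, Complex.norm_real, norm_inv, norm_norm,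
    inv_mul_cancel₀ (norm_ne_zero_iff.2 hu)]

theorem triangulates : complexCP2.Triangulates ComplexProjectivePlane := by
  have hne : ∀ u : Metric.sphere (0 : ℂ × ℂ) 1, u.1 ≠ 0 := fun u => by
    intro h
    have := u.2
    rw [h] at this
    simp at this
  let i : Metric.sphere (0 : ℂ × ℂ) 1 → {u : ℂ × ℂ // u ≠ 0} := fun u => ⟨u.1, hne u⟩
  have hi : Continuous i := by fun_prop
  let A : Metric.sphere (0 : ℂ × ℂ) 1 × Metric.sphere (0 : ℂ × ℂ) 1 → complexCP2.carrier :=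
    fun x => ⟨fold (transport (hopf x.1.1) (hopf x.2.1)),
      fold_mem_carrier (transport_mem_carrier (hopf_mem (hne _)) (hopf_mem (hne _)))⟩
  let B : Metric.sphere (0 : ℂ × ℂ) 1 × Metric.sphere (0 : ℂ × ℂ) 1 → ComplexProjectivePlane :=
    fun x => symPoint (i x.1) (i x.2)
  have hhopf : Continuous fun u : Metric.sphere (0 : ℂ × ℂ) 1 => hopf u.1 :=
    continuousOn_hopf.comp_continuous continuous_subtype_val hne
  refine nonempty_homeomorph_of_fibers (A := A) (B := B) ?_ ?_ ?_ ?_ ?_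
  · refine Continuous.subtype_mk (continuous_fold.comp (continuous_transport.comp
      ((hhopf.comp continuous_fst).prodMk (hhopf.comp continuous_snd)))) _
  · exact continuous_symPoint.comp ((hi.comp continuous_fst).prodMk (hi.comp continuous_snd))
  · rintro ⟨g, hg⟩
    obtain ⟨p, hp, q, hq, rfl⟩ := exists_fold_transport hg
    obtain ⟨u, hu, rfl⟩ := exists_hopf_eq hp
    obtain ⟨w, hw, rfl⟩ := exists_hopf_eq hq
    obtain ⟨c, hc, hcu⟩ := exists_sphere_smul hu
    obtain ⟨d, hd, hdw⟩ := exists_sphere_smul hw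
    refine ⟨(⟨_, hcu⟩, ⟨_, hdw⟩), Subtype.ext ?_⟩
    simp only [A, hopf_smul hc, hopf_smul hd]
  · intro x
    obtain ⟨u, w, rfl⟩ := exists_symPoint_eq x
    obtain ⟨c, hc, hcu⟩ := exists_sphere_smul u.2
    obtain ⟨d, hd, hdw⟩ := exists_sphere_smul w.2
    refine ⟨(⟨_, hcu⟩, ⟨_, hdw⟩), symPoint_eq_of_parallel ?_ ?_⟩ <;>
      simp only [i, Parallel, Prod.smul_fst, Prod.smul_snd, smul_eq_mul] <;> ring
  · rintro ⟨u, w⟩ ⟨u', w'⟩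
    rw [Subtype.ext_iff, symPoint_eq_iff]
    simp only [A, i]
    rw [fold_transport_eq_iff (hopf_mem (hne _)) (hopf_mem (hne _)) (hopf_mem (hne _))
      (hopf_mem (hne _)), hopf_eq_hopf_iff (hne _) (hne _), hopf_eq_hopf_iff (hne _) (hne _),
      hopf_eq_hopf_iff (hne _) (hne _), hopf_eq_hopf_iff (hne _) (hne _)]

/-! ### Automorphisms of `ℂP²₁₀` -/

/-- The action of a permutation of the indices on the vertices of `ℂP²₁₀`. -/
noncomputable def inducedPerm (σ : Equiv.Perm (Fin 4)) : Equiv.Perm CP2Vertex where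
  toFun o := vertexEquivSym2.symm (Sym2.map σ (vertexEquivSym2 o))
  invFun o := vertexEquivSym2.symm (Sym2.map σ.symm (vertexEquivSym2 o))
  left_inv o := by simp [Sym2.map_map]
  right_inv o := by simp [Sym2.map_map]

theorem vertexEquivSym2_symm_mk (i j : Fin 4) : vertexEquivSym2.symm s(i, j) = vertexCP2 i j := rfl

theorem inducedPerm_vertexCP2 (σ : Equiv.Perm (Fin 4)) (i j : Fin 4) :
    inducedPerm σ (vertexCP2 i j) = vertexCP2 (σ i) (σ j) := by
  change vertexEquivSym2.symm (Sym2.map σ (vertexEquivSym2 (vertexCP2 i j))) = _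
  rw [← vertexEquivSym2_symm_mk i j, Equiv.apply_symm_apply, Sym2.map_mk, vertexEquivSym2_symm_mk]

theorem inducedPerm_orbitOf (σ : Equiv.Perm (Fin 4)) (v : Fin 4 × Fin 4) :
    inducedPerm σ (orbitOf v) = orbitOf (indexPerm σ v) :=
  inducedPerm_vertexCP2 σ v.1 v.2

theorem perm_ext {g h : Equiv.Perm CP2Vertex}
    (H : ∀ i j, g (vertexCP2 i j) = h (vertexCP2 i j)) : g = h := by
  ext o
  obtain ⟨i, j, rfl⟩ := exists_vertexCP2 o
  exact H i j

theorem map_inducedPerm_mem {σ : Equiv.Perm (Fin 4)} (hσ : σ ∈ alternatingGroup (Fin 4))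
    {t : Finset CP2Vertex} (ht : t ∈ complexCP2.faces) :
    t.map (inducedPerm σ).toEmbedding ∈ complexCP2.faces := by
  classical
  obtain ⟨s, hne, hs, rfl⟩ := mem_complexCP2_faces.1 ht
  refine mem_complexCP2_faces.2 ⟨s.map (indexPerm σ).toEmbedding, hne.map, hs.map_indexPerm hσ, ?_⟩
  ext o
  simp only [Finset.mem_image, Finset.mem_map, exists_exists_and_eq_and, Equiv.coe_toEmbedding,
    inducedPerm_orbitOf]

theorem inducedPerm_mem {σ : Equiv.Perm (Fin 4)} (hσ : σ ∈ alternatingGroup (Fin 4)) :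
    inducedPerm σ ∈ complexCP2.automorphismGroup := by
  intro t
  refine ⟨fun h => ?_, map_inducedPerm_mem hσ⟩
  have h' := map_inducedPerm_mem (inv_mem hσ) h
  rw [Finset.map_map] at h'
  convert h'
  refine (Finset.map_refl (s := t)).symm.trans ?_
  congr 1
  ext o
  obtain ⟨i, j, rfl⟩ := exists_vertexCP2 o
  simp [inducedPerm_vertexCP2]

/-- The action of the alternating group on `ℂP²₁₀`. -/
noncomputable def inducedHom : alternatingGroup (Fin 4) →* complexCP2.automorphismGroup :=
  MonoidHom.mk' (fun σ => ⟨inducedPerm σ, inducedPerm_mem σ.2⟩) fun σ τ =>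
    Subtype.ext (perm_ext fun i j => by simp [inducedPerm_vertexCP2])

theorem inducedHom_injective : Function.Injective inducedHom := by
  intro σ τ h
  refine Subtype.ext (Equiv.ext fun i => ?_)
  have h1 : inducedPerm σ = inducedPerm τ := congrArg Subtype.val h
  have h2 := congrArg (fun g : Equiv.Perm CP2Vertex => g (vertexCP2 i i)) h1
  simp only [inducedPerm_vertexCP2, vertexCP2_eq_iff] at h2
  tauto

/-- The images of `u`, `v`, `w` in `ℂP²₁₀` have pairwise compatible preimages. As at most three rows
and three columns are involved, this means that they span a simplex. -/
def CompatibleTriple (u v w : Fin 4 × Fin 4) : Prop :=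
  ∃ u' ∈ ({u, flip u} : Finset (Fin 4 × Fin 4)), ∃ v' ∈ ({v, flip v} : Finset (Fin 4 × Fin 4)),
    ∃ w' ∈ ({w, flip w} : Finset (Fin 4 × Fin 4)),
      Compatible u' v' ∧ Compatible u' w' ∧ Compatible v' w'

instance (u v w : Fin 4 × Fin 4) : Decidable (CompatibleTriple u v w) := by
  unfold CompatibleTriple; infer_instance

theorem compatible_self : ∀ v, Compatible v v := by decide +kernel

theorem compatible_symm : ∀ v w, Compatible v w → Compatible w v := by decide +kernel

theorem exists_ne_of_three : ∀ i j k : Fin 4, ∃ l, i ≠ l ∧ j ≠ l ∧ k ≠ l := by decide +kernel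

open Classical in
theorem triple_mem_faces_iff (u v w : Fin 4 × Fin 4) :
    {orbitOf u, orbitOf v, orbitOf w} ∈ complexCP2.faces ↔ CompatibleTriple u v w := by
  rw [mem_complexCP2_faces]
  constructor
  · rintro ⟨s, -, hs, he⟩
    have hex : ∀ x, orbitOf x ∈ ({orbitOf u, orbitOf v, orbitOf w} : Finset CP2Vertex) →
        ∃ x' ∈ ({x, flip x} : Finset (Fin 4 × Fin 4)), x' ∈ s := by
      intro x hx
      rw [← he] at hx
      obtain ⟨x', hx', e⟩ := Finset.mem_image.1 hx
      exact ⟨x', by simpa using (orbitOf_eq_iff _ _).1 e, hx'⟩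
    obtain ⟨u', hu, hu'⟩ := hex u (by simp)
    obtain ⟨v', hv, hv'⟩ := hex v (by simp)
    obtain ⟨w', hw, hw'⟩ := hex w (by simp)
    exact ⟨u', hu, v', hv, w', hw, hs.1 _ hu' _ hv', hs.1 _ hu' _ hw', hs.1 _ hv' _ hw'⟩
  · rintro ⟨u', hu, v', hv, w', hw, huv, huw, hvw⟩
    refine ⟨{u', v', w'}, by simp, ⟨?_, ?_, ?_⟩, ?_⟩
    · simp [compatible_self, huv, huw, hvw, compatible_symm _ _ huv, compatible_symm _ _ huw,
        compatible_symm _ _ hvw]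
    · obtain ⟨l, h1, h2, h3⟩ := exists_ne_of_three u'.1 v'.1 w'.1
      exact ⟨l, by simp only [Finset.forall_mem_insert, Finset.mem_singleton, forall_eq]
                   exact ⟨h1, h2, h3⟩⟩
    · obtain ⟨l, h1, h2, h3⟩ := exists_ne_of_three u'.2 v'.2 w'.2
      exact ⟨l, by simp only [Finset.forall_mem_insert, Finset.mem_singleton, forall_eq]
                   exact ⟨h1, h2, h3⟩⟩
    · have hmem : ∀ x x' : Fin 4 × Fin 4, x' ∈ ({x, flip x} : Finset (Fin 4 × Fin 4)) →
          orbitOf x' = orbitOf x := fun x x' h => (orbitOf_eq_iff _ _).2 (by simpa using h)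
      simp [Finset.image_insert, hmem u u' hu, hmem v v' hv, hmem w w' hw]

theorem compatibleTriple_diag : ∀ i v w, CompatibleTriple (i, i) v w := by
  decide +kernel

theorem exists_not_compatibleTriple : ∀ i j : Fin 4, i ≠ j →
    ∃ k, ¬CompatibleTriple (i, j) (j, k) (k, i) := by
  decide +kernel

theorem not_compatibleTriple_of_odd : ∀ σ : Equiv.Perm (Fin 4), Equiv.Perm.sign σ ≠ 1 →
    ¬CompatibleTriple (σ 0, σ 1) (σ 1, σ 2) (σ 2, σ 3) := by
  decide +kernel

open Classical in
/-- Three of the four vertices `x_{ii}`, all but `x_{ll}`, span a simplex with an off-diagonal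
vertex if and only if `l` is not an index of that vertex. -/
theorem insert_diag_mem_faces_iff (l : Fin 4) {v : Fin 4 × Fin 4} (hv : v.1 ≠ v.2) :
    insert (orbitOf v) ((Finset.univ.erase l).image fun i => vertexCP2 i i) ∈ complexCP2.faces ↔
      v.1 ≠ l ∧ v.2 ≠ l := by
  rw [mem_complexCP2_faces]
  constructor
  · rintro ⟨s, -, ⟨-, ⟨k, hk⟩, m, hm⟩, he⟩
    have hdiag : ∀ i, i ≠ l → (i, i) ∈ s := by
      intro i hi
      have : orbitOf (i, i) ∈ s.image orbitOf := by
        rw [he]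
        exact Finset.mem_insert_of_mem
          (Finset.mem_image_of_mem (fun i => vertexCP2 i i) (by simpa using hi))
      obtain ⟨w, hw, e⟩ := Finset.mem_image.1 this
      rcases (orbitOf_eq_iff _ _).1 e with rfl | rfl <;> exact hw
    have hkl : k = l := by_contra fun h => hk _ (hdiag k h) rfl
    have hml : m = l := by_contra fun h => hm _ (hdiag m h) rfl
    subst hkl hml
    have : orbitOf v ∈ s.image orbitOf := by
      rw [he]
      exact Finset.mem_insert_self _ _
    obtain ⟨w, hw, e⟩ := Finset.mem_image.1 this
    rcases (orbitOf_eq_iff _ _).1 e with rfl | rfl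
    · exact ⟨hk _ hw, hm _ hw⟩
    · exact ⟨hm _ hw, hk _ hw⟩
  · rintro ⟨h1, h2⟩
    refine ⟨insert v ((Finset.univ.erase l).image fun i => (i, i)), by simp,
      ⟨?_, ⟨l, ?_⟩, l, ?_⟩, ?_⟩
    · intro x hx y hy
      simp only [Finset.mem_insert, Finset.mem_image] at hx hy
      rcases hx with rfl | ⟨i, -, rfl⟩
      · rcases hy with rfl | ⟨j, -, rfl⟩
        · exact compatible_self _
        · exact Or.inr (Or.inl rfl)
      · exact Or.inl rfl
    · simpa using h1
    · simpa using h2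
    · rw [Finset.image_insert, Finset.image_image]
      rfl

open Classical in
/-- Automorphisms preserve the set of the vertices `x_{ii}`: every other vertex lies in a triple of
vertices which is not a simplex, whereas the `x_{ii}` do not. -/
theorem exists_apply_diag {g : Equiv.Perm CP2Vertex} (hg : g ∈ complexCP2.automorphismGroup)
    (i : Fin 4) : ∃ k, g (vertexCP2 i i) = vertexCP2 k k := by
  obtain ⟨j, k, hjk⟩ := exists_vertexCP2 (g (vertexCP2 i i))
  by_cases h : j = k
  · exact ⟨j, by rw [← hjk, h]⟩
  obtain ⟨l, hl⟩ := exists_not_compatibleTriple j k h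
  refine absurd ?_ hl
  rw [← triple_mem_faces_iff]
  obtain ⟨v, hv⟩ := orbitOf_surjective (g.symm (orbitOf (k, l)))
  obtain ⟨w, hw⟩ := orbitOf_surjective (g.symm (orbitOf (l, j)))
  have := (hg _).2 ((triple_mem_faces_iff (i, i) v w).2 (compatibleTriple_diag i v w))
  rw [hv, hw] at this
  simp only [Finset.map_insert, Finset.map_singleton, Equiv.coe_toEmbedding,
    Equiv.apply_symm_apply] at this
  rwa [show g (orbitOf (i, i)) = orbitOf (j, k) from hjk.symm] at this

theorem inducedHom_surjective : Function.Surjective inducedHom := by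
  classical
  rintro ⟨g, hg⟩
  choose τ' hτ' using exists_apply_diag hg
  have hinj : Function.Injective τ' := by
    intro i j hij
    have h : g (vertexCP2 i i) = g (vertexCP2 j j) := by rw [hτ', hτ', hij]
    have := (vertexCP2_eq_iff _ _ _ _).1 (g.injective h)
    tauto
  obtain ⟨τ, rfl⟩ : ∃ τ : Equiv.Perm (Fin 4), ⇑τ = τ' :=
    ⟨Equiv.ofBijective τ' (Finite.injective_iff_bijective.1 hinj), rfl⟩
  -- `g` acts on the off-diagonal vertices as it does on the diagonal ones
  have hoff : ∀ i j, i ≠ j → g (vertexCP2 i j) = vertexCP2 (τ i) (τ j) := by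
    intro i j hij
    obtain ⟨k, m, hkm⟩ := exists_vertexCP2 (g (vertexCP2 i j))
    have hne : k ≠ m := by
      rintro rfl
      have h : g (vertexCP2 i j) = g (vertexCP2 (τ.symm k) (τ.symm k)) := by
        rw [hτ', ← hkm, Equiv.apply_symm_apply]
      have := (vertexCP2_eq_iff _ _ _ _).1 (g.injective h)
      exact hij (by rcases this with ⟨h1, h2⟩ | ⟨h1, h2⟩ <;> rw [h1, h2])
    have key : ∀ l, (k ≠ τ l ∧ m ≠ τ l) ↔ (i ≠ l ∧ j ≠ l) := by
      intro l
      rw [← insert_diag_mem_faces_iff (τ l) (v := (k, m)) hne,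
        ← insert_diag_mem_faces_iff l (v := (i, j)) hij]
      have hmap : (insert (orbitOf (i, j)) ((Finset.univ.erase l).image fun i => vertexCP2 i i)).map
          g.toEmbedding =
          insert (orbitOf (k, m)) ((Finset.univ.erase (τ l)).image fun i => vertexCP2 i i) := by
        rw [Finset.map_insert]
        congr 1
        · exact hkm.symm
        · ext o
          simp only [Finset.mem_map, Finset.mem_image, Finset.mem_erase, Finset.mem_univ, and_true,
            exists_exists_and_eq_and, Equiv.coe_toEmbedding, hτ']
          constructor
          · rintro ⟨a, ha, rfl⟩
            exact ⟨τ a, τ.injective.ne ha, rfl⟩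
          · rintro ⟨a, ha, rfl⟩
            exact ⟨τ.symm a, fun e => ha (by rw [← e, Equiv.apply_symm_apply]), by simp⟩
      rw [← hmap]
      exact hg _
    have h1 := key i
    have h2 := key j
    have h3 := τ.injective.ne hij
    rw [← hkm, vertexCP2_eq_iff]
    simp only [ne_eq, not_true_eq_false, false_and, and_false, iff_false, not_and_or, not_not]
      at h1 h2
    rcases h1 with h1 | h1 <;> rcases h2 with h2 | h2
    · exact absurd (h1.symm.trans h2) h3
    · exact Or.inl ⟨h1, h2⟩
    · exact Or.inr ⟨h2, h1⟩
    · exact absurd (h1.symm.trans h2) h3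
  have hall : ∀ i j, g (vertexCP2 i j) = vertexCP2 (τ i) (τ j) := by
    intro i j
    rcases eq_or_ne i j with rfl | hij
    · exact hτ' i
    · exact hoff i j hij
  -- the simplex spanned by the orbits of `x_{12}`, `x_{23}`, `x_{34}` is not mapped to a
  -- simplex by an odd permutation
  have heven : τ ∈ alternatingGroup (Fin 4) := by
    rw [Equiv.Perm.mem_alternatingGroup]
    by_contra hodd
    refine not_compatibleTriple_of_odd τ hodd ((triple_mem_faces_iff _ _ _).1 ?_)
    have h := (hg _).2 ((triple_mem_faces_iff (0, 1) (1, 2) (2, 3)).2 (by decide +kernel))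
    simpa only [Finset.map_insert, Finset.map_singleton, Equiv.coe_toEmbedding, orbitOf, hall]
      using h
  exact ⟨⟨τ, heven⟩, Subtype.ext (perm_ext fun i j =>
    (inducedPerm_vertexCP2 τ i j).trans (hall i j).symm)⟩

end S2xS2

theorem corollary2 :
    complexCP2.vertices.ncard = 10 ∧
    complexCP2.Triangulates ComplexProjectivePlane ∧
    ∃ e : alternatingGroup (Fin 4) ≃* complexCP2.automorphismGroup,
      ∀ (σ : alternatingGroup (Fin 4)) (i j : Fin 4),
        (e σ : Equiv.Perm CP2Vertex) (vertexCP2 i j) =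
          vertexCP2 ((σ : Equiv.Perm (Fin 4)) i) ((σ : Equiv.Perm (Fin 4)) j) :=
  ⟨S2xS2.ncard_vertices, S2xS2.triangulates,
    MulEquiv.ofBijective S2xS2.inducedHom ⟨S2xS2.inducedHom_injective, S2xS2.inducedHom_surjective⟩,
    fun σ i j => S2xS2.inducedPerm_vertexCP2 σ i j⟩
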